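/- An ample groupoid is a topological groupoid $\mathcal G$, not necessarily Hausdorff, whose unit space $\mathcal G^0$ is locally compact, Hausdorff and totally disconnected and whose source map $s$ is a local homeomorphism; its range map is denoted by $r$. For a topological space $X$, let $\mathbb ZX$ be the group of functions $X\to\mathbb Z$ generated by the characteristic functions of compact (quasi-compact and Hausdorff) open subsets of $X$. Then $\mathbb Z\mathcal G$ is a ring (with local units, in general without identity) under convolution $(f*h)(g)=\sum_{r(a)=r(g)}f(a)h(a^{-1}g)$, and $\mathbb Z\mathcal G^0$ is a unitary right $\mathbb Z\mathcal G$-module via $(hf)(x)=\sum_{s(g)=x}h(r(g))f(g)$, and dually a left module. A left $\mathbb Z\mathcal G$-module $M$ is unitary if $\mathbb Z\mathcal G\cdot M=M$, where $\mathbb Z\mathcal G\cdot M$ is the additive span of all products. For such $M$ and $n\ge 0$ put $H_n(\mathcal G,M)=\operatorname{Tor}_n^{\mathbb Z\mathcal G}(\mathbb Z\mathcal G^0,M)$, where Tor is computed by projective resolutions of $\mathbb Z\mathcal G^0$ in the category of unitary right $\mathbb Z\mathcal G$-modules, and put $H_n(\mathcal G)=H_n(\mathcal G,\mathbb Z\mathcal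 G^0)$. Theorem (continuity of homology). Let $\mathcal G$ be an ample groupoid which is a directed union $\mathcal G=\bigcup_{i\in D}\mathcal H_i$ of open subgroupoids $\mathcal H_i$ (not required to contain all units of $\mathcal G$), that is, $D$ is a nonempty directed set and $\mathcal H_i\subseteq\mathcal H_j$ for $i\le j$. Then for every unitary left $\mathbb Z\mathcal G$-module $M$ and every $n\ge 0$, the groups $H_n(\mathcal H_i,\mathbb Z\mathcal H_i\cdot M)$ with the maps induced by the inclusions form a directed system of abelian groups, and the maps to $H_n(\mathcal G,M)$ induced by the inclusions give an isomorphism \[\varinjlim_{i\in D} H_n(\mathcal H_i,\mathbb Z\mathcal H_i\cdot M)\;\cong\; H_n(\mathcal G,M).\] In particular, the maps induced by the inclusions (extension by zero $\mathbb Z\mathcal H_i^0\to\mathbb Z\mathcal H_j^0$ and $\mathbb Z\mathcal H_i^0\to\mathbb Z\mathcal G^0$ on coefficients) give an isomorphism $\varinjlim_{i\in D} H_n(\mathcal H_i)\cong H_n(\mathcal G)$. -/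

import Mathlib

open scoped TensorProduct MulOpposite

universe u v w

noncomputable section

/-! ### Modules over rings without unit, and their Tor groups -/

/-- A left module over a ring `R` which need not have a unit.  Right `R`-modules are
`RngModule Rᵐᵒᵖ`, the right action of `x` on `a` being `MulOpposite.op x • a`. -/
class RngModule (R : Type u) (M : Type v) [NonUnitalRing R] [AddCommGroup M] extends
    SMul R M where
  smul_add : ∀ (x : R) (m m' : M), x • (m + m') = x • m + x • m'
  add_smul : ∀ (x y : R) (m : M), (x + y) • m = x • m + y • m
  mul_smul : ∀ (x y : R) (m : M), (x * y) • m = x • (y • m)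

namespace RngModule

variable {R : Type u} {M : Type v} [NonUnitalRing R] [AddCommGroup M] [RngModule R M]

/-- The action of one ring element as an additive map. -/
def smulHom (x : R) : M →+ M := AddMonoidHom.mk' (fun m => x • m) (smul_add x)

/-- The action on one element of the module as an additive map. -/
def smulHom' (m : M) : R →+ M := AddMonoidHom.mk' (fun x => x • m) (fun x y => add_smul x y m)

theorem smul_zero (x : R) : x • (0 : M) = 0 := (smulHom (M := M) x).map_zero
theorem smul_neg (x : R) (m : M) : x • (-m) = -(x • m) := (smulHom (M := M) x).map_neg m
theorem zero_smul (m : M) : (0 : R) • m = 0 := (smulHom' (R := R) m).map_zero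
theorem neg_smul (x : R) (m : M) : (-x) • m = -(x • m) := (smulHom' (R := R) m).map_neg x

variable (R M) in
/-- A module `M` is unitary if `R · M = M`, where `R · M` is the additive span of all products. -/
def IsUnitary : Prop := AddSubgroup.closure {m : M | ∃ (x : R) (m' : M), m = x • m'} = ⊤

end RngModule

/-- `R` has local units: every finite subset is fixed, from both sides, by an idempotent. -/
class HasLocalUnits (R : Type u) [NonUnitalRing R] : Prop where
  exists_unit : ∀ t : Finset R, ∃ e : R, e * e = e ∧ ∀ x ∈ t, e * x = x ∧ x * e = x

open MulOpposite (op)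

/-- A bundled unitary right module over `R`. -/
structure UnitaryRightModule (R : Type u) [NonUnitalRing R] where
  carrier : Type u
  [addCommGroup : AddCommGroup carrier]
  [module : RngModule Rᵐᵒᵖ carrier]
  unitary : RngModule.IsUnitary Rᵐᵒᵖ carrier

namespace UnitaryRightModule

attribute [instance] addCommGroup module

instance (R : Type u) [NonUnitalRing R] : CoeSort (UnitaryRightModule R) (Type u) := ⟨carrier⟩

variable {R : Type u} [NonUnitalRing R]

/-- Homomorphisms of right `R`-modules. -/
structure Hom (A B : UnitaryRightModule R) extends A.carrier →+ B.carrier where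
  map_smul : ∀ (x : R) (a : A), toFun (op x • a) = op x • toFun a

/-- The additive map underlying a module homomorphism. -/
abbrev Hom.add {A B : UnitaryRightModule R} (f : Hom A B) : A →+ B := f.toAddMonoidHom

/-- `P` is a projective object of the category of unitary right `R`-modules. -/
def IsProjective (P : UnitaryRightModule R) : Prop :=
  ∀ (N N' : UnitaryRightModule R) (p : Hom N N') (f : Hom P N'), Function.Surjective p.add →
    ∃ g : Hom P N, ∀ x, p.add (g.add x) = f.add x

theorem isUnitary_of_forall {A : Type u} [AddCommGroup A] [RngModule Rᵐᵒᵖ A]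
    (h : ∀ a : A, ∃ e : R, op e • a = a) : RngModule.IsUnitary Rᵐᵒᵖ A := by
  refine (AddSubgroup.eq_top_iff' _).2 fun a => ?_
  obtain ⟨e, he⟩ := h a
  exact AddSubgroup.subset_closure ⟨op e, a, he.symm⟩

theorem exists_idem [HasLocalUnits R] (A : UnitaryRightModule R) (a : A) :
    ∃ e : R, e * e = e ∧ op e • a = a := by
  have key : ∃ t : Finset R, ∀ e : R, (∀ x ∈ t, x * e = x) → op e • a = a := by
    have ha : a ∈ AddSubgroup.closure {m : A | ∃ (x : Rᵐᵒᵖ) (m' : A), m = x • m'} := by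
      have := A.unitary
      rw [RngModule.IsUnitary] at this
      rw [this]; trivial
    classical
    induction ha using AddSubgroup.closure_induction with
    | mem a h =>
      obtain ⟨x, m', rfl⟩ := h
      refine ⟨{x.unop}, fun e he => ?_⟩
      rw [← RngModule.mul_smul]
      congr 1
      exact MulOpposite.unop_injective (he x.unop (by simp))
    | zero => exact ⟨∅, fun e _ => RngModule.smul_zero _⟩
    | add a b _ _ ha hb =>
      obtain ⟨t, ht⟩ := ha
      obtain ⟨t', ht'⟩ := hb
      refine ⟨t ∪ t', fun e he => ?_⟩
      rw [RngModule.smul_add, ht e fun x hx => he x (by simp [hx]),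
        ht' e fun x hx => he x (by simp [hx])]
    | neg a _ ha =>
      obtain ⟨t, ht⟩ := ha
      exact ⟨t, fun e he => by rw [RngModule.smul_neg, ht e he]⟩
  obtain ⟨t, ht⟩ := key
  obtain ⟨e, he, h⟩ := HasLocalUnits.exists_unit t
  exact ⟨e, he, ht e fun x hx => (h x hx).2⟩

/-! #### The functorial projective cover `⨁ eR → A`

The sum runs over the pairs `(e, a)` with `e` idempotent and `a = ae`; the summand `eR` of the
pair `(e, a)` maps to `A` by `x ↦ ax`. -/

/-- The index set of the direct sum. -/
def CoverIndex (A : UnitaryRightModule R) : Type u :=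
  {j : R × A.carrier // j.1 * j.1 = j.1 ∧ op j.1 • j.2 = j.2}

/-- The direct sum of the right modules `eR`. -/
def coverGroup (A : UnitaryRightModule R) : AddSubgroup (CoverIndex A →₀ R) where
  carrier := {F | ∀ j, j.1.1 * F j = F j}
  zero_mem' := by intro j; simp
  add_mem' := by intro F F' h h' j; simp [mul_add, h j, h' j]
  neg_mem' := by intro F h j; simp [h j]

theorem single_mem_coverGroup (A : UnitaryRightModule R) (j : CoverIndex A) (x : R)
    (h : j.1.1 * x = x) : Finsupp.single j x ∈ coverGroup A := by
  classical
  intro k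
  by_cases hk : j = k
  · subst hk; simpa using h
  · simp [hk]

instance (A : UnitaryRightModule R) : RngModule Rᵐᵒᵖ (coverGroup A) where
  smul x F := ⟨F.1.mapRange (· * x.unop) (zero_mul _), fun j => by
    simp [← mul_assoc, F.2 j]⟩
  smul_add x F F' := by
    ext j; exact add_mul (F.1 j) (F'.1 j) x.unop
  add_smul x y F := by
    ext j; exact mul_add (F.1 j) x.unop y.unop
  mul_smul x y F := by
    ext j; exact (mul_assoc (F.1 j) y.unop x.unop).symm

theorem cover_smul_apply (A : UnitaryRightModule R) (x : R) (F : coverGroup A)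
    (j : CoverIndex A) : (op x • F).1 j = F.1 j * x := rfl

/-- The module `⨁ eR`. -/
def cover [HasLocalUnits R] (A : UnitaryRightModule R) : UnitaryRightModule R where
  carrier := coverGroup A
  unitary := isUnitary_of_forall fun F => by
    classical
    obtain ⟨e, -, he⟩ := HasLocalUnits.exists_unit (F.1.support.image F.1)
    refine ⟨e, ?_⟩
    ext j
    rw [cover_smul_apply]
    by_cases hj : F.1 j = 0
    · simp [hj]
    · exact (he _ (Finset.mem_image_of_mem _ (by simpa using hj))).2

/-- An additive map out of `⨁ eR` given by one element for each summand. -/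
def coverLift [HasLocalUnits R] (A B : UnitaryRightModule R) (b : CoverIndex A → B) :
    Hom (cover A) B where
  toAddMonoidHom := (Finsupp.liftAddHom fun j =>
    (AddMonoidHom.mk' (fun x : R => op x • b j) fun x y => by
      rw [MulOpposite.op_add, RngModule.add_smul])).comp (coverGroup A).subtype
  map_smul x F := by
    change Finsupp.sum _ _ = op x • Finsupp.sum _ _
    change ((F : coverGroup A).1.mapRange (· * x) (zero_mul _)).sum (fun j x => op x • b j) = _
    rw [Finsupp.sum_mapRange_index (fun j => by
      simpa using RngModule.zero_smul (R := Rᵐᵒᵖ) (b j))]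
    change _ = RngModule.smulHom (op x) _
    rw [map_finsuppSum]
    refine Finsupp.sum_congr fun j _ => ?_
    rw [MulOpposite.op_mul, RngModule.mul_smul]
    rfl

theorem coverLift_single [HasLocalUnits R] (A B : UnitaryRightModule R) (b : CoverIndex A → B)
    (j : CoverIndex A) (x : R) (h) :
    (coverLift A B b).add (⟨Finsupp.single j x, h⟩ : coverGroup A) = op x • b j := by
  change (Finsupp.single j x).sum (fun j x => op x • b j) = _
  exact Finsupp.sum_single_index (by simpa using RngModule.zero_smul (R := Rᵐᵒᵖ) (b j))

/-- The surjection `⨁ eR → A`. -/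
def coverMap [HasLocalUnits R] (A : UnitaryRightModule R) : Hom (cover A) A :=
  coverLift A A fun j => j.1.2

theorem coverMap_surjective [HasLocalUnits R] (A : UnitaryRightModule R) :
    Function.Surjective (coverMap A).add := by
  intro a
  obtain ⟨e, he, ha⟩ := exists_idem A a
  refine ⟨⟨Finsupp.single ⟨(e, a), he, ha⟩ e, single_mem_coverGroup A _ _ he⟩, ?_⟩
  exact (coverLift_single A A _ _ _ _).trans ha

theorem cover_projective [HasLocalUnits R] (A : UnitaryRightModule R) : IsProjective (cover A) := by
  intro N N' p f hp
  have hgen : ∀ j : CoverIndex A, ∃ n : N, p.add n =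
      f.add (⟨Finsupp.single j j.1.1, single_mem_coverGroup A _ _ j.2.1⟩ : coverGroup A) :=
    fun j => hp _
  choose n hn using hgen
  refine ⟨coverLift A N n, fun F => ?_⟩
  have key : ∀ (G : CoverIndex A →₀ R) (hG : G ∈ coverGroup A),
      p.add ((coverLift A N n).add (⟨G, hG⟩ : coverGroup A)) =
        f.add (⟨G, hG⟩ : coverGroup A) := by
    intro G
    induction G using Finsupp.induction with
    | zero =>
      intro hG
      exact ((p.add.comp (coverLift A N n).add).map_zero).trans f.add.map_zero.symm
    | single_add j x G hj hx ih =>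
      intro hG
      have hGj : G j = 0 := by simpa using hj
      have hxj : j.1.1 * x = x := by
        have := hG j
        simpa [hGj] using this
      have h1 := single_mem_coverGroup A j x hxj
      have h2 : G ∈ coverGroup A := by
        have := (coverGroup A).sub_mem hG h1
        simpa using this
      have hsplit : (⟨Finsupp.single j x + G, hG⟩ : coverGroup A) = ⟨_, h1⟩ + ⟨G, h2⟩ := rfl
      have e1 := (p.add.comp (coverLift A N n).add).map_add
        (⟨Finsupp.single j x, h1⟩ : coverGroup A) (⟨G, h2⟩ : coverGroup A)
      have e2 := f.add.map_add (⟨Finsupp.single j x, h1⟩ : coverGroup A) (⟨G, h2⟩ : coverGroup A)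
      rw [hsplit]
      refine e1.trans (Eq.trans ?_ e2.symm)
      refine congrArg₂ (· + ·) ?_ (ih h2)
      change p.add ((coverLift A N n).add _) = _
      rw [coverLift_single]
      refine (p.map_smul x (n j)).trans ?_
      change op x • p.add (n j) = _
      rw [hn j]
      refine (f.map_smul x _).symm.trans ?_
      change f.add _ = f.add _
      congr 1
      refine Subtype.ext ?_
      change (Finsupp.single j j.1.1).mapRange (· * x) (zero_mul _) = Finsupp.single j x
      rw [Finsupp.mapRange_single, hxj]
  exact key F.1 F.2

/-- The kernel of `⨁ eR → A`. -/
def syzygyGroup [HasLocalUnits R] (A : UnitaryRightModule R) : AddSubgroup (cover A) :=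
  (coverMap A).add.ker

instance [HasLocalUnits R] (A : UnitaryRightModule R) : RngModule Rᵐᵒᵖ (syzygyGroup A) where
  smul x F := ⟨x • F.1, by
    have h : (coverMap A).add F.1 = 0 := F.2
    refine ((coverMap A).map_smul x.unop F.1).trans ?_
    exact (congrArg (op x.unop • ·) h).trans (RngModule.smul_zero _)⟩
  smul_add x F F' := Subtype.ext (RngModule.smul_add x F.1 F'.1)
  add_smul x y F := Subtype.ext (RngModule.add_smul x y F.1)
  mul_smul x y F := Subtype.ext (RngModule.mul_smul x y F.1)

/-- The kernel of `⨁ eR → A`, as a right module. -/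
def syzygy [HasLocalUnits R] (A : UnitaryRightModule R) : UnitaryRightModule R where
  carrier := syzygyGroup A
  unitary := isUnitary_of_forall fun F => by
    obtain ⟨e, -, he⟩ := exists_idem (cover A) F.1
    exact ⟨e, Subtype.ext he⟩

/-- The inclusion of the kernel. -/
def syzygyIncl [HasLocalUnits R] (A : UnitaryRightModule R) : Hom (syzygy A) (cover A) where
  toAddMonoidHom := (syzygyGroup A).subtype
  map_smul _ _ := rfl

/-- Composition of module homomorphisms. -/
def Hom.comp {A B C : UnitaryRightModule R} (g : Hom B C) (f : Hom A B) : Hom A C where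
  toAddMonoidHom := g.add.comp f.add
  map_smul x a := (congrArg g.add (f.map_smul x a)).trans (g.map_smul x _)

/-- A projective resolution of `A` in the category of unitary right modules. -/
structure ProjectiveResolution (A : UnitaryRightModule R) where
  obj : ℕ → UnitaryRightModule R
  projective : ∀ n, IsProjective (obj n)
  d : ∀ n, Hom (obj (n + 1)) (obj n)
  ε : Hom (obj 0) A
  surjective : Function.Surjective ε.add
  exact_zero : (d 0).add.range = ε.add.ker
  exact_succ : ∀ n, (d (n + 1)).add.range = (d n).add.ker

/-- Iterated kernels. -/
def iterSyzygy [HasLocalUnits R] (A : UnitaryRightModule R) : ℕ → UnitaryRightModule R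
  | 0 => A
  | n + 1 => syzygy (iterSyzygy A n)

/-- The standard projective resolution, obtained by iterating the cover `⨁ eR → A`. -/
def standardResolution [HasLocalUnits R] (A : UnitaryRightModule R) : ProjectiveResolution A where
  obj n := cover (iterSyzygy A n)
  projective n := cover_projective _
  d n := (syzygyIncl (iterSyzygy A n)).comp (coverMap (syzygy (iterSyzygy A n)))
  ε := coverMap A
  surjective := coverMap_surjective A
  exact_zero := by
    ext F
    constructor
    · rintro ⟨F', rfl⟩
      exact ((coverMap (syzygy A)).add F' : syzygyGroup A).2
    · intro h
      obtain ⟨F', hF'⟩ := coverMap_surjective (syzygy A) (⟨F, h⟩ : syzygyGroup A)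
      exact ⟨F', congrArg (syzygyIncl A).add hF'⟩
  exact_succ n := by
    ext F
    constructor
    · rintro ⟨F', rfl⟩
      have h := ((coverMap (syzygy (syzygy (iterSyzygy A n)))).add F' :
        syzygyGroup (syzygy (iterSyzygy A n))).2
      exact congrArg (syzygyIncl (iterSyzygy A n)).add h
    · intro h
      obtain ⟨F', hF'⟩ := coverMap_surjective (syzygy (syzygy (iterSyzygy A n)))
        (⟨F, Subtype.ext h⟩ : syzygyGroup (syzygy (iterSyzygy A n)))
      exact ⟨F', congrArg (syzygyIncl _).add hF'⟩

/-! #### Tensor products over `R` and Tor -/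

/-- The subgroup generated by the elements `ax ⊗ m - a ⊗ xm`. -/
def balanced (A : UnitaryRightModule R) (M : Type v) [AddCommGroup M] [RngModule R M] :
    AddSubgroup (A.carrier ⊗[ℤ] M) :=
  AddSubgroup.closure {t | ∃ (a : A) (x : R) (m : M),
    t = (op x • a) ⊗ₜ[ℤ] m - a ⊗ₜ[ℤ] (x • m)}

/-- The abelian group `A ⊗_R M`. -/
abbrev Tens (A : UnitaryRightModule R) (M : Type v) [AddCommGroup M] [RngModule R M] :
    Type (max u v) := (A.carrier ⊗[ℤ] M) ⧸ balanced A M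

/-- The map `A ⊗_R M → A' ⊗_S M'` induced by a ring homomorphism `φ : R → S` and by additive
maps `A → A'`, `M → M'` which are compatible with `φ`. -/
def Tens.map {S : Type u} [NonUnitalRing S] (φ : R →ₙ+* S)
    {A : UnitaryRightModule R} {A' : UnitaryRightModule S}
    {M : Type v} [AddCommGroup M] [RngModule R M] {M' : Type v} [AddCommGroup M'] [RngModule S M']
    (α : A →+ A') (hα : ∀ (x : R) (a : A), α (op x • a) = op (φ x) • α a)
    (β : M →+ M') (hβ : ∀ (x : R) (m : M), β (x • m) = φ x • β m) :
    Tens A M →+ Tens A' M' :=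
  QuotientAddGroup.map _ _
    (TensorProduct.map α.toIntLinearMap β.toIntLinearMap).toAddMonoidHom (by
      refine (AddSubgroup.closure_le _).2 ?_
      rintro _ ⟨a, x, m, rfl⟩
      refine AddSubgroup.subset_closure ⟨α a, φ x, β m, ?_⟩
      simp [map_sub, hα, hβ])

variable (M : Type v) [AddCommGroup M] [RngModule R M]

namespace ProjectiveResolution

variable {A : UnitaryRightModule R} (P : ProjectiveResolution A)

/-- The differential of `P ⊗_R M`. -/
def dTens (n : ℕ) : Tens (P.obj (n + 1)) M →+ Tens (P.obj n) M :=
  Tens.map (NonUnitalRingHom.id R) (P.d n).add (P.d n).map_smul (AddMonoidHom.id M)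
    fun _ _ => rfl

/-- The `n`-cycles of `P ⊗_R M`. -/
def cycles : ∀ n : ℕ, AddSubgroup (Tens (P.obj n) M)
  | 0 => ⊤
  | n + 1 => (P.dTens M n).ker

/-- The `n`-th homology group of `P ⊗_R M`: cycles modulo boundaries. -/
abbrev Homology (n : ℕ) : Type (max u v) :=
  P.cycles M n ⧸ (P.dTens M n).range.addSubgroupOf (P.cycles M n)

end ProjectiveResolution

/-- `Tor_n^R(A, M)` for a unitary right module `A` and a left module `M`. -/
abbrev Tor [HasLocalUnits R] (n : ℕ) (A : UnitaryRightModule R) : Type (max u v) :=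
  (standardResolution A).Homology M n

/-! #### Functoriality of Tor in the ring and both modules -/

section Functoriality

variable {S : Type u} [NonUnitalRing S] (φ : R →ₙ+* S)

/-- Additive maps `A → A'` compatible with a ring homomorphism `φ : R → S`. -/
structure SemiHom (A : UnitaryRightModule R) (A' : UnitaryRightModule S) extends
    A.carrier →+ A'.carrier where
  map_smul : ∀ (x : R) (a : A), toFun (op x • a) = op (φ x) • toFun a

/-- The underlying additive map. -/
abbrev SemiHom.add {φ : R →ₙ+* S} {A : UnitaryRightModule R} {A' : UnitaryRightModule S}
    (f : SemiHom φ A A') : A →+ A' := f.toAddMonoidHom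

variable {φ} [HasLocalUnits R] [HasLocalUnits S]
  {A : UnitaryRightModule R} {A' : UnitaryRightModule S}

/-- The pair `(e, a)` is sent to `(φ e, α a)`. -/
def CoverIndex.map (α : SemiHom φ A A') (j : CoverIndex A) : CoverIndex A' :=
  ⟨(φ j.1.1, α.add j.1.2), by rw [← map_mul, j.2.1], by
    exact (α.map_smul j.1.1 j.1.2).symm.trans (congrArg α.add j.2.2)⟩

/-- The map `⨁ eR → ⨁ e'S` which is `φ : eR → φ(e)S` on the summand of `(e, a)`. -/
def coverSemi (α : SemiHom φ A A') : SemiHom φ (cover A) (cover A') where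
  toAddMonoidHom := ((Finsupp.liftAddHom fun j : CoverIndex A =>
    (Finsupp.singleAddHom (CoverIndex.map α j)).comp φ.toAddMonoidHom).comp
      (coverGroup A).subtype).codRestrict (coverGroup A') (fun F => by
        refine AddSubgroup.sum_mem _ fun j _ => single_mem_coverGroup A' _ _ ?_
        exact (map_mul φ _ _).symm.trans (congrArg φ (F.2 j)))
  map_smul x F := by
    refine Subtype.ext ?_
    change ((F : coverGroup A).1.mapRange (· * x) (zero_mul _)).sum
      (fun j x => Finsupp.single (CoverIndex.map α j) (φ x)) =
      ((F : coverGroup A).1.sum fun j x => Finsupp.single (CoverIndex.map α j) (φ x)).mapRange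
        (AddMonoidHom.mulRight (φ x)) (map_zero _)
    rw [Finsupp.sum_mapRange_index (fun j => by simp), Finsupp.sum, Finsupp.sum,
      Finsupp.mapRange_finsetSum]
    simp

theorem coverMap_coverSemi (α : SemiHom φ A A') (F : cover A) :
    (coverMap A').add ((coverSemi α).add F) = α.add ((coverMap A).add F) := by
  change Finsupp.liftAddHom _ (Finsupp.sum _ _) = α.add (Finsupp.sum _ _)
  rw [map_finsuppSum, map_finsuppSum]
  refine Finsupp.sum_congr fun j _ => ?_
  refine (Finsupp.liftAddHom_apply_single _ _ _).trans ?_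
  exact (α.map_smul _ _).symm

/-- The induced map on kernels. -/
def syzygySemi (α : SemiHom φ A A') : SemiHom φ (syzygy A) (syzygy A') where
  toAddMonoidHom := ((coverSemi α).add.comp (syzygyGroup A).subtype).codRestrict (syzygyGroup A')
    fun F => by
      have h : (coverMap A).add F.1 = 0 := F.2
      refine (coverMap_coverSemi α F.1).trans ?_
      rw [h, map_zero]
  map_smul x F := Subtype.ext ((coverSemi α).map_smul x (F : syzygyGroup A).1)

/-- The induced map on iterated kernels. -/
def iterSyzygySemi (α : SemiHom φ A A') : ∀ n, SemiHom φ (iterSyzygy A n) (iterSyzygy A' n)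
  | 0 => α
  | n + 1 => syzygySemi (iterSyzygySemi α n)

/-- The map of standard resolutions which lifts `α`. -/
def resolutionMap (α : SemiHom φ A A') (n : ℕ) :
    SemiHom φ ((standardResolution A).obj n) ((standardResolution A').obj n) :=
  coverSemi (iterSyzygySemi α n)

theorem resolutionMap_d (α : SemiHom φ A A') (n : ℕ) (F : (standardResolution A).obj (n + 1)) :
    (resolutionMap α n).add (((standardResolution A).d n).add F) =
      ((standardResolution A').d n).add ((resolutionMap α (n + 1)).add F) :=
  (congrArg Subtype.val (coverMap_coverSemi (syzygySemi (iterSyzygySemi α n)) F)).symm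

theorem resolutionMap_ε (α : SemiHom φ A A') (F : (standardResolution A).obj 0) :
    (standardResolution A').ε.add ((resolutionMap α 0).add F) =
      α.add ((standardResolution A).ε.add F) :=
  coverMap_coverSemi α F

variable {M : Type v} [AddCommGroup M] [RngModule R M]
  {M' : Type v} [AddCommGroup M'] [RngModule S M']

/-- The chain map `P ⊗_R M → P' ⊗_S M'`. -/
def chainMap (α : SemiHom φ A A') (β : M →+ M') (hβ : ∀ (x : R) (m : M), β (x • m) = φ x • β m)
    (n : ℕ) : Tens ((standardResolution A).obj n) M →+ Tens ((standardResolution A').obj n) M' :=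
  Tens.map φ (resolutionMap α n).add (resolutionMap α n).map_smul β hβ

theorem chainMap_d (α : SemiHom φ A A') (β : M →+ M')
    (hβ : ∀ (x : R) (m : M), β (x • m) = φ x • β m) (n : ℕ)
    (t : Tens ((standardResolution A).obj (n + 1)) M) :
    chainMap α β hβ n ((standardResolution A).dTens M n t) =
      (standardResolution A').dTens M' n (chainMap α β hβ (n + 1) t) := by
  obtain ⟨t, rfl⟩ := QuotientAddGroup.mk_surjective t
  induction t using TensorProduct.induction_on with
  | zero =>
    exact (((chainMap α β hβ n).comp ((standardResolution A).dTens M n)).map_zero).trans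
      (((standardResolution A').dTens M' n).comp (chainMap α β hβ (n + 1))).map_zero.symm
  | tmul F m =>
    exact congrArg (fun y => (QuotientAddGroup.mk (y ⊗ₜ[ℤ] β m) :
      Tens ((standardResolution A').obj n) M')) (resolutionMap_d α n F)
  | add t t' h h' =>
    have e1 := ((chainMap α β hβ n).comp ((standardResolution A).dTens M n)).map_add
      (QuotientAddGroup.mk t) (QuotientAddGroup.mk t')
    have e2 := (((standardResolution A').dTens M' n).comp (chainMap α β hβ (n + 1))).map_add
      (QuotientAddGroup.mk t) (QuotientAddGroup.mk t')
    exact e1.trans ((congrArg₂ (· + ·) h h').trans e2.symm)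

/-- The restriction of the chain map to cycles. -/
def cyclesMap (α : SemiHom φ A A') (β : M →+ M')
    (hβ : ∀ (x : R) (m : M), β (x • m) = φ x • β m) (n : ℕ) :
    (standardResolution A).cycles M n →+ (standardResolution A').cycles M' n :=
  ((chainMap α β hβ n).comp ((standardResolution A).cycles M n).subtype).codRestrict _ (by
    rintro ⟨t, ht⟩
    cases n with
    | zero => trivial
    | succ n =>
      have ht : (standardResolution A).dTens M n t = 0 := ht
      change (standardResolution A').dTens M' n (chainMap α β hβ (n + 1) t) = 0
      rw [← chainMap_d, ht, map_zero])

/-- The homomorphism `Tor_n^R(A, M) → Tor_n^S(A', M')` induced by a ring homomorphism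
`φ : R → S` and by maps `α : A → A'`, `β : M → M'` compatible with `φ`. -/
def Tor.map (α : SemiHom φ A A') (β : M →+ M')
    (hβ : ∀ (x : R) (m : M), β (x • m) = φ x • β m) (n : ℕ) : Tor M n A →+ Tor M' n A' :=
  QuotientAddGroup.map _ _ (cyclesMap α β hβ n) (by
    rintro ⟨t, ht⟩ ⟨t', h⟩
    exact ⟨chainMap α β hβ (n + 1) t', by
      rw [← chainMap_d, h]; rfl⟩)

end Functoriality

end UnitaryRightModule
/-! ### The group `ℤX` -/

/-- The group `ℤX` of functions `X → ℤ` generated by the characteristic functions of the compact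
(that is, quasi-compact and Hausdorff) open subsets of `X`. -/
def ZFun (X : Type u) [TopologicalSpace X] : AddSubgroup (X → ℤ) :=
  AddSubgroup.closure {f | ∃ U : Set X, IsOpen U ∧ IsCompact U ∧ T2Space U ∧ f = U.indicator 1}

/-! ### Ample groupoids -/

/-- An ample groupoid.  The product `mul g h` is defined when `s g = r h`.  The groupoid need
not be Hausdorff. -/
structure AmpleGroupoid where
  Obj : Type u
  Arr : Type u
  [topObj : TopologicalSpace Obj]
  [topArr : TopologicalSpace Arr]
  s : Arr → Obj
  r : Arr → Obj
  one : Obj → Arr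
  inv : Arr → Arr
  mul : ∀ g h : Arr, s g = r h → Arr
  s_one : ∀ x, s (one x) = x
  r_one : ∀ x, r (one x) = x
  s_inv : ∀ g, s (inv g) = r g
  r_inv : ∀ g, r (inv g) = s g
  s_mul : ∀ g h e, s (mul g h e) = s h
  r_mul : ∀ g h e, r (mul g h e) = r g
  mul_assoc : ∀ (g h k : Arr) (e : s g = r h) (e' : s h = r k),
    mul (mul g h e) k ((s_mul g h e).trans e') = mul g (mul h k e') (e.trans (r_mul h k e').symm)
  one_mul : ∀ g, mul (one (r g)) g (s_one _) = g
  mul_one : ∀ g, mul g (one (s g)) (r_one _).symm = g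
  inv_mul : ∀ g, mul (inv g) g (s_inv g) = one (s g)
  mul_inv : ∀ g, mul g (inv g) (r_inv g).symm = one (r g)
  continuous_s : Continuous s
  continuous_r : Continuous r
  continuous_one : Continuous one
  continuous_inv : Continuous inv
  continuous_mul : Continuous fun p : {p : Arr × Arr // s p.1 = r p.2} => mul p.1.1 p.1.2 p.2
  locallyCompact : LocallyCompactSpace Obj
  t2 : T2Space Obj
  totallyDisconnected : TotallyDisconnectedSpace Obj
  isLocalHomeomorph_s : IsLocalHomeomorph s

namespace AmpleGroupoid

attribute [instance] topObj topArr locallyCompact t2 totallyDisconnected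

variable (G : AmpleGroupoid.{u})

theorem mul_inv_cancel_left (a g : G.Arr) (e : G.r a = G.r g) :
    G.mul a (G.mul (G.inv a) g ((G.s_inv a).trans e))
      ((G.r_inv a).symm.trans (G.r_mul _ _ _).symm) = g := by
  rw [← G.mul_assoc a (G.inv a) g (G.r_inv a).symm ((G.s_inv a).trans e)]
  have : ∀ (x : G.Arr) (e' : G.s x = G.r g), x = G.one (G.r g) → G.mul x g e' = g := by
    rintro _ e' rfl
    exact G.one_mul g
  exact this _ _ (by rw [G.mul_inv, e])

theorem inv_mul_cancel_left (a b : G.Arr) (e : G.s a = G.r b) :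
    G.mul (G.inv a) (G.mul a b e) ((G.s_inv a).trans (G.r_mul _ _ _).symm) = b := by
  rw [← G.mul_assoc (G.inv a) a b (G.s_inv a) e]
  have : ∀ (x : G.Arr) (e' : G.s x = G.r b), x = G.one (G.r b) → G.mul x b e' = b := by
    rintro _ e' rfl
    exact G.one_mul b
  exact this _ _ (by rw [G.inv_mul, e])

theorem inv_inv (g : G.Arr) : G.inv (G.inv g) = g := by
  have h := G.mul_inv_cancel_left (G.inv g) (G.one (G.s g)) (by rw [G.r_inv, G.r_one])
  have h2 := G.inv_mul_cancel_left (G.inv g) g (G.s_inv g)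
  have h3 : G.mul (G.inv (G.inv g)) (G.one (G.s (G.inv (G.inv g)))) (G.r_one _).symm
      = G.inv (G.inv g) := G.mul_one _
  rw [← h3]
  refine Eq.trans ?_ h2
  congr 1
  rw [G.inv_mul, G.s_inv, G.r_inv]

theorem isLocalHomeomorph_r : IsLocalHomeomorph G.r := by
  have : G.r = G.s ∘ G.inv := by ext g; exact (G.s_inv g).symm
  rw [this]
  let e : G.Arr ≃ₜ G.Arr :=
    { toFun := G.inv, invFun := G.inv, left_inv := G.inv_inv, right_inv := G.inv_inv
      continuous_toFun := G.continuous_inv, continuous_invFun := G.continuous_inv }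
  exact G.isLocalHomeomorph_s.comp e.isLocalHomeomorph

theorem isOpenEmbedding_one : Topology.IsOpenEmbedding G.one := by
  have h : G.s ∘ G.one = id := funext G.s_one
  refine IsLocalHomeomorph.isOpenEmbedding_of_comp G.isLocalHomeomorph_s ?_ G.continuous_one
  rw [h]
  exact Topology.IsOpenEmbedding.id

theorem exists_compact_open {x : G.Obj} {V : Set G.Obj} (hV : IsOpen V) (hx : x ∈ V) :
    ∃ K : Set G.Obj, IsOpen K ∧ IsCompact K ∧ x ∈ K ∧ K ⊆ V := by
  obtain ⟨N, hN, hxN, hNV⟩ := exists_compact_subset hV hx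
  obtain ⟨C, hC, hxC, hCN⟩ := (loc_compact_Haus_tot_disc_of_zero_dim (H := G.Obj)).exists_subset_of_mem_open
    hxN isOpen_interior
  exact ⟨C, hC.isOpen, hN.of_isClosed_subset hC.isClosed (hCN.trans interior_subset), hxC,
    (hCN.trans interior_subset).trans hNV⟩

/-- Compact bisections. -/
structure IsCBis (B : Set G.Arr) : Prop where
  isOpen : IsOpen B
  isCompact : IsCompact B
  injOn_s : Set.InjOn G.s B
  injOn_r : Set.InjOn G.r B

variable {G}

theorem IsCBis.t2Space {B : Set G.Arr} (h : G.IsCBis B) : T2Space B :=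
  T2Space.of_injective_continuous (f := fun b : B => G.s b)
    (fun _ _ e => Subtype.ext (h.injOn_s (Subtype.mem _) (Subtype.mem _) e))
    (G.continuous_s.comp continuous_subtype_val)

theorem IsCBis.mem_zfun {B : Set G.Arr} (h : G.IsCBis B) : B.indicator 1 ∈ ZFun G.Arr :=
  AddSubgroup.subset_closure ⟨B, h.isOpen, h.isCompact, h.t2Space, rfl⟩

theorem IsCBis.sub {B C : Set G.Arr} (h : G.IsCBis B) (hCB : C ⊆ B) (ho : IsOpen C)
    (hc : IsCompact C) : G.IsCBis C :=
  ⟨ho, hc, h.injOn_s.mono hCB, h.injOn_r.mono hCB⟩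

theorem exists_cbis {g : G.Arr} {U : Set G.Arr} (hU : IsOpen U) (hg : g ∈ U) :
    ∃ B, G.IsCBis B ∧ g ∈ B ∧ B ⊆ U := by
  obtain ⟨e, he, hs⟩ := G.isLocalHomeomorph_s g
  obtain ⟨e', he', hr⟩ := G.isLocalHomeomorph_r g
  set W : Set G.Arr := (e.source ∩ e'.source) ∩ U with hW
  have hWo : IsOpen W := (e.open_source.inter e'.open_source).inter hU
  have hgW : g ∈ W := ⟨⟨he, he'⟩, hg⟩
  have hinj : Set.InjOn G.s W := by
    rw [hs]; exact e.injOn.mono fun x hx => hx.1.1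
  have hinj' : Set.InjOn G.r W := by
    rw [hr]; exact e'.injOn.mono fun x hx => hx.1.2
  obtain ⟨K, hKo, hKc, hgK, hKW⟩ := G.exists_compact_open
    (G.isLocalHomeomorph_s.isOpenMap W hWo) (Set.mem_image_of_mem G.s hgW)
  refine ⟨W ∩ G.s ⁻¹' K, ⟨hWo.inter (hKo.preimage G.continuous_s), ?_,
    hinj.mono Set.inter_subset_left, hinj'.mono Set.inter_subset_left⟩, ⟨hgW, hgK⟩,
    fun x hx => hx.1.2⟩
  have : W ∩ G.s ⁻¹' K = e.symm '' K := by
    ext x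
    constructor
    · rintro ⟨hx, hxK⟩
      refine ⟨G.s x, hxK, ?_⟩
      rw [hs]; exact e.left_inv hx.1.1
    · rintro ⟨k, hk, rfl⟩
      obtain ⟨w, hw, rfl⟩ := hKW hk
      have : e.symm (G.s w) = w := by rw [hs]; exact e.left_inv hw.1.1
      rw [this]
      exact ⟨hw, hk⟩
  rw [this]
  refine hKc.image_of_continuousOn (e.continuousOn_symm.mono fun k hk => ?_)
  obtain ⟨w, hw, rfl⟩ := hKW hk
  rw [hs]; exact e.map_source hw.1.1

/-- `ℤG` is spanned by the characteristic functions of compact bisections. -/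
theorem zfun_arr_eq : ZFun G.Arr =
    AddSubgroup.closure {f | ∃ B, G.IsCBis B ∧ f = B.indicator 1} := by
  apply le_antisymm
  · refine (AddSubgroup.closure_le _).2 ?_
    rintro _ ⟨U, hUo, hUc, hU2, rfl⟩
    have key : ∀ t : Set (Set G.Arr), t.Finite → (∀ B ∈ t, G.IsCBis B ∧ B ⊆ U) →
        (⋃₀ t).indicator 1 ∈
          AddSubgroup.closure {f : G.Arr → ℤ | ∃ B, G.IsCBis B ∧ f = B.indicator 1} := by
      intro t ht
      induction t, ht using Set.Finite.induction_on with
      | empty =>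
        intro _
        rw [Set.sUnion_empty, Set.indicator_empty]
        exact zero_mem _
      | @insert B t _ htf ih =>
        intro h
        have hB := h B (Set.mem_insert _ _)
        have ht' : ∀ B ∈ t, G.IsCBis B ∧ B ⊆ U := fun C hC => h C (Set.mem_insert_of_mem _ hC)
        have hAo : IsOpen (⋃₀ t) := isOpen_sUnion fun C hC => (ht' C hC).1.isOpen
        have hAc : IsCompact (⋃₀ t) := htf.isCompact_sUnion fun C hC => (ht' C hC).1.isCompact
        have hAU : ⋃₀ t ⊆ U := Set.sUnion_subset fun C hC => (ht' C hC).2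
        have hsplit : (⋃₀ (insert B t)).indicator (1 : G.Arr → ℤ) =
            (⋃₀ t).indicator 1 + (B \ ⋃₀ t).indicator 1 := by
          refine Eq.trans ?_ (Set.indicator_union_of_disjoint Set.disjoint_sdiff_right _)
          rw [Set.sUnion_insert, Set.union_sdiff_self, Set.union_comm]
        rw [hsplit]
        refine AddSubgroup.add_mem _ (ih ht') (AddSubgroup.subset_closure
          ⟨_, hB.1.sub Set.sdiff_subset ?_ (hB.1.isCompact.diff hAo), rfl⟩)
        have hcl : IsClosed ((↑) ⁻¹' (⋃₀ t) : Set U) := by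
          refine IsCompact.isClosed ?_
          refine (Topology.IsInducing.subtypeVal.isCompact_preimage_iff ?_).2 hAc
          simpa using hAU
        have : B \ ⋃₀ t = B ∩ ((↑) '' ((↑) ⁻¹' (⋃₀ t) : Set U)ᶜ) := by
          ext x
          constructor
          · rintro ⟨hx, hx'⟩
            exact ⟨hx, ⟨x, hB.2 hx⟩, hx', rfl⟩
          · rintro ⟨hx, ⟨y, hy, rfl⟩⟩
            exact ⟨hx, hy⟩
        rw [this]
        exact hB.1.isOpen.inter (hUo.isOpenMap_subtype_val _ hcl.isOpen_compl)
    have hcov := hUc.elim_finite_subcover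
      (fun B : {B : Set G.Arr // G.IsCBis B ∧ B ⊆ U} => B.1) (fun B => B.2.1.isOpen)
      (fun g hg => by
        obtain ⟨B, hB, hgB, hBU⟩ := exists_cbis hUo hg
        exact Set.mem_iUnion.2 ⟨⟨B, hB, hBU⟩, hgB⟩)
    obtain ⟨t, ht⟩ := hcov
    have h := key (Subtype.val '' (t : Set {B : Set G.Arr // G.IsCBis B ∧ B ⊆ U}))
      (t.finite_toSet.image _) (by rintro _ ⟨B, _, rfl⟩; exact B.2)
    have hU : ⋃₀ (Subtype.val '' (t : Set {B : Set G.Arr // G.IsCBis B ∧ B ⊆ U})) = U := by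
      apply subset_antisymm
      · refine Set.sUnion_subset ?_
        rintro _ ⟨B, _, rfl⟩
        exact B.2.2
      · intro x hx
        obtain ⟨B, hB⟩ := Set.mem_iUnion.1 (ht hx)
        obtain ⟨hBt, hxB⟩ := Set.mem_iUnion.1 hB
        exact ⟨B.1, ⟨B, hBt, rfl⟩, hxB⟩
    rwa [hU] at h
  · refine (AddSubgroup.closure_le _).2 ?_
    rintro _ ⟨B, hB, rfl⟩
    exact hB.mem_zfun

theorem zfun_induction (f : G.Arr → ℤ) (hf : f ∈ ZFun G.Arr) {p : (G.Arr → ℤ) → Prop}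
    (bis : ∀ B, G.IsCBis B → p (B.indicator 1))
    (zero : p 0) (add : ∀ f ∈ ZFun G.Arr, ∀ h ∈ ZFun G.Arr, p f → p h → p (f + h))
    (neg : ∀ f ∈ ZFun G.Arr, p f → p (-f)) : p f := by
  rw [zfun_arr_eq] at hf
  induction hf using AddSubgroup.closure_induction with
  | mem f h => obtain ⟨B, hB, rfl⟩ := h; exact bis B hB
  | zero => exact zero
  | add f h hf hh pf ph => rw [← zfun_arr_eq] at hf hh; exact add f hf h hh pf ph
  | neg f hf pf => rw [← zfun_arr_eq] at hf; exact neg f hf pf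

theorem finite_r_fiber {f : G.Arr → ℤ} (hf : f ∈ ZFun G.Arr) (x : G.Obj) :
    {g | G.r g = x ∧ f g ≠ 0}.Finite := by
  refine zfun_induction (p := fun f => {g | G.r g = x ∧ f g ≠ 0}.Finite)
    f hf (fun B hB => ?_) (by simp) (fun f _ h _ pf ph => ?_) (fun f _ pf => ?_)
  · refine Set.Subsingleton.finite ?_
    rintro g ⟨hg, hgB⟩ g' ⟨hg', hgB'⟩
    exact hB.injOn_r (Set.mem_of_indicator_ne_zero hgB) (Set.mem_of_indicator_ne_zero hgB')
      (hg.trans hg'.symm)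
  · refine (pf.union ph).subset ?_
    rintro g ⟨hg, hfg⟩
    by_contra hcon
    simp only [Set.mem_union, Set.mem_ofPred_eq, hg, true_and, not_or, not_not] at hcon
    exact hfg (by simp [hcon])
  · simpa using pf

theorem finite_s_fiber {f : G.Arr → ℤ} (hf : f ∈ ZFun G.Arr) (x : G.Obj) :
    {g | G.s g = x ∧ f g ≠ 0}.Finite := by
  refine zfun_induction (p := fun f => {g | G.s g = x ∧ f g ≠ 0}.Finite)
    f hf (fun B hB => ?_) (by simp) (fun f _ h _ pf ph => ?_) (fun f _ pf => ?_)
  · refine Set.Subsingleton.finite ?_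
    rintro g ⟨hg, hgB⟩ g' ⟨hg', hgB'⟩
    exact hB.injOn_s (Set.mem_of_indicator_ne_zero hgB) (Set.mem_of_indicator_ne_zero hgB')
      (hg.trans hg'.symm)
  · refine (pf.union ph).subset ?_
    rintro g ⟨hg, hfg⟩
    by_contra hcon
    simp only [Set.mem_union, Set.mem_ofPred_eq, hg, true_and, not_or, not_not] at hcon
    exact hfg (by simp [hcon])
  · simpa using pf

/-! ### Convolution -/

variable (G) in
/-- The convolution product `(f * h)(g) = ∑_{r(a) = r(g)} f(a) h(a⁻¹g)`. -/
def conv (f h : G.Arr → ℤ) (g : G.Arr) : ℤ :=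
  ∑ᶠ a : {a : G.Arr // G.r a = G.r g}, f a * h (G.mul (G.inv a) g ((G.s_inv a).trans a.2))

theorem conv_support_finite {f : G.Arr → ℤ} (hf : f ∈ ZFun G.Arr) (x : G.Obj)
    (F : {a : G.Arr // G.r a = x} → ℤ) :
    (Function.support fun a : {a : G.Arr // G.r a = x} => f a * F a).Finite := by
  refine ((finite_r_fiber hf x).preimage Subtype.val_injective.injOn).subset ?_
  intro a ha
  exact ⟨a.2, left_ne_zero_of_mul ha⟩

theorem conv_add_left {f f' : G.Arr → ℤ} (hf : f ∈ ZFun G.Arr) (hf' : f' ∈ ZFun G.Arr)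
    (h : G.Arr → ℤ) : G.conv (f + f') h = G.conv f h + G.conv f' h := by
  ext g
  refine Eq.trans ?_ (finsum_add_distrib (conv_support_finite hf _ _)
    (conv_support_finite hf' _ _))
  exact finsum_congr fun a => add_mul _ _ _

theorem conv_add_right {f : G.Arr → ℤ} (hf : f ∈ ZFun G.Arr) (h h' : G.Arr → ℤ) :
    G.conv f (h + h') = G.conv f h + G.conv f h' := by
  ext g
  refine Eq.trans ?_ (finsum_add_distrib (conv_support_finite hf _ _)
    (conv_support_finite hf _ _))
  exact finsum_congr fun a => mul_add _ _ _

theorem conv_zero_left (h : G.Arr → ℤ) : G.conv 0 h = 0 := by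
  ext g; simp [conv]

theorem conv_zero_right (h : G.Arr → ℤ) : G.conv h 0 = 0 := by
  ext g; simp [conv]

theorem conv_neg_left (f h : G.Arr → ℤ) : G.conv (-f) h = -G.conv f h := by
  ext g; simp [conv, finsum_neg_distrib]

theorem conv_neg_right (f h : G.Arr → ℤ) : G.conv f (-h) = -G.conv f h := by
  ext g; simp [conv, finsum_neg_distrib]

theorem conv_of_mem {B : Set G.Arr} (hB : Set.InjOn G.r B) (h : G.Arr → ℤ) {a g : G.Arr}
    (ha : a ∈ B) (e : G.r a = G.r g) :
    G.conv (B.indicator 1) h g = h (G.mul (G.inv a) g ((G.s_inv a).trans e)) := by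
  refine (finsum_eq_single _ ⟨a, e⟩ fun a' ha' => ?_).trans (by simp [ha])
  have : a'.1 ∉ B := fun hm => ha' (Subtype.ext (hB hm ha (a'.2.trans e.symm)))
  simp [this]

theorem conv_of_forall {B : Set G.Arr} (h : G.Arr → ℤ) {g : G.Arr}
    (hn : ∀ a ∈ B, G.r a ≠ G.r g) : G.conv (B.indicator 1) h g = 0 := by
  refine finsum_eq_zero_of_forall_eq_zero fun a => ?_
  have : a.1 ∉ B := fun hm => hn _ hm a.2
  simp [this]

/-- The setwise product of `U` and `V`. -/
def setProd (U V : Set G.Arr) : Set G.Arr :=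
  {g | ∃ a ∈ U, ∃ e : G.r a = G.r g, G.mul (G.inv a) g ((G.s_inv a).trans e) ∈ V}

theorem setProd_eq_image (U V : Set G.Arr) : setProd U V =
    (fun p : {p : G.Arr × G.Arr // G.s p.1 = G.r p.2} => G.mul p.1.1 p.1.2 p.2) ''
      (Subtype.val ⁻¹' (U ×ˢ V)) := by
  ext g
  constructor
  · rintro ⟨a, ha, e, hb⟩
    exact ⟨⟨(a, _), (G.r_inv a).symm.trans (G.r_mul _ _ _).symm⟩, ⟨ha, hb⟩,
      G.mul_inv_cancel_left a g e⟩
  · rintro ⟨⟨⟨a, b⟩, e⟩, ⟨ha, hb⟩, rfl⟩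
    exact ⟨a, ha, (G.r_mul _ _ _).symm, by
      change G.mul (G.inv a) (G.mul a b e) _ ∈ V
      rw [G.inv_mul_cancel_left a b e]; exact hb⟩

theorem IsCBis.setProd {U V : Set G.Arr} (hU : G.IsCBis U) (hV : G.IsCBis V) :
    G.IsCBis (setProd U V) where
  isOpen := by
    let L : {p : G.Arr × G.Arr // G.r p.1 = G.r p.2} → G.Arr := fun p =>
      G.mul (G.inv p.1.1) p.1.2 ((G.s_inv p.1.1).trans p.2)
    have hL : Continuous L := G.continuous_mul.comp
      (f := fun p : {p : G.Arr × G.Arr // G.r p.1 = G.r p.2} =>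
        (⟨(G.inv p.1.1, p.1.2), (G.s_inv p.1.1).trans p.2⟩ :
          {p : G.Arr × G.Arr // G.s p.1 = G.r p.2}))
      (Continuous.subtype_mk ((G.continuous_inv.comp
        (continuous_fst.comp continuous_subtype_val)).prodMk
        (continuous_snd.comp continuous_subtype_val)) _)
    obtain ⟨O, hO, hOV⟩ := isOpen_induced_iff.1 (hV.isOpen.preimage hL)
    rw [isOpen_iff_mem_nhds]
    rintro g ⟨a, ha, e, hb⟩
    have hag : (a, g) ∈ O := by
      have : (⟨(a, g), e⟩ : {p : G.Arr × G.Arr // G.r p.1 = G.r p.2}) ∈ L ⁻¹' V := hb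
      rw [← hOV] at this
      exact this
    obtain ⟨A, C, hA, hC, haA, hgC, hAC⟩ := isOpen_prod_iff.1 hO a g hag
    refine Filter.mem_of_superset (((hC.inter ((G.isLocalHomeomorph_r.isOpenMap _
      (hA.inter hU.isOpen)).preimage G.continuous_r))).mem_nhds
      ⟨hgC, ⟨a, ⟨haA, ha⟩, e⟩⟩) ?_
    rintro g' ⟨hg', a', ⟨ha'A, ha'U⟩, e'⟩
    refine ⟨a', ha'U, e', ?_⟩
    have : (⟨(a', g'), e'⟩ : {p : G.Arr × G.Arr // G.r p.1 = G.r p.2}) ∈ L ⁻¹' V := by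
      rw [← hOV]
      exact hAC ⟨ha'A, hg'⟩
    exact this
  isCompact := by
    rw [setProd_eq_image]
    refine IsCompact.image ?_ G.continuous_mul
    have hcl : IsClosed {p : G.Arr × G.Arr | G.s p.1 = G.r p.2} :=
      isClosed_eq (G.continuous_s.comp continuous_fst) (G.continuous_r.comp continuous_snd)
    exact hcl.isClosedEmbedding_subtypeVal.isCompact_preimage (hU.isCompact.prod hV.isCompact)
  injOn_s := by
    rintro g ⟨a, ha, e, hb⟩ g' ⟨a', ha', e', hb'⟩ hgg
    have h1 := hV.injOn_s hb hb' (by rw [G.s_mul, G.s_mul, hgg])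
    have h2 : G.s a = G.s a' := by
      have := congrArg G.r h1
      rwa [G.r_mul, G.r_mul, G.r_inv, G.r_inv] at this
    have h3 := hU.injOn_s ha ha' h2
    subst h3
    rw [← G.mul_inv_cancel_left a g e, ← G.mul_inv_cancel_left a g' e']
    congr 1
  injOn_r := by
    rintro g ⟨a, ha, e, hb⟩ g' ⟨a', ha', e', hb'⟩ hgg
    have h3 := hU.injOn_r ha ha' (by rw [e, e', hgg])
    subst h3
    have h1 := hV.injOn_r hb hb' (by rw [G.r_mul, G.r_mul])
    rw [← G.mul_inv_cancel_left a g e, ← G.mul_inv_cancel_left a g' e']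
    congr 1

theorem conv_bis {U : Set G.Arr} (hU : Set.InjOn G.r U) (V : Set G.Arr) :
    G.conv (U.indicator 1) (V.indicator 1) = (setProd U V).indicator 1 := by
  ext g
  by_cases h : ∃ a ∈ U, G.r a = G.r g
  · obtain ⟨a, ha, e⟩ := h
    rw [conv_of_mem hU _ ha e]
    by_cases hm : G.mul (G.inv a) g ((G.s_inv a).trans e) ∈ V
    · rw [Set.indicator_of_mem hm, Set.indicator_of_mem (s := setProd U V) ⟨a, ha, e, hm⟩]; rfl
    · rw [Set.indicator_of_notMem hm, Set.indicator_of_notMem]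
      rintro ⟨a', ha', e', hm'⟩
      have h3 := hU ha ha' (e.trans e'.symm)
      subst h3
      exact hm hm'
  · push Not at h
    rw [conv_of_forall _ h, Set.indicator_of_notMem]
    rintro ⟨a, ha, e, -⟩
    exact h a ha e

theorem conv_mem {f h : G.Arr → ℤ} (hf : f ∈ ZFun G.Arr) (hh : h ∈ ZFun G.Arr) :
    G.conv f h ∈ ZFun G.Arr := by
  refine zfun_induction (p := fun f => G.conv f h ∈ ZFun G.Arr)
    f hf (fun U hU => ?_) (by rw [conv_zero_left]; exact zero_mem _)
    (fun f hf f' hf' pf pf' => by rw [conv_add_left hf hf']; exact add_mem pf pf')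
    (fun f _ pf => by rw [conv_neg_left]; exact neg_mem pf)
  refine zfun_induction (p := fun h => G.conv (U.indicator 1) h ∈ ZFun G.Arr)
    h hh (fun V hV => ?_) (by rw [conv_zero_right]; exact zero_mem _)
    (fun f hf f' hf' pf pf' => by rw [conv_add_right hU.mem_zfun]; exact add_mem pf pf')
    (fun f _ pf => by rw [conv_neg_right]; exact neg_mem pf)
  rw [conv_bis hU.injOn_r]
  exact (hU.setProd hV).mem_zfun

theorem conv_assoc {f h : G.Arr → ℤ} (hf : f ∈ ZFun G.Arr) (hh : h ∈ ZFun G.Arr)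
    (k : G.Arr → ℤ) : G.conv (G.conv f h) k = G.conv f (G.conv h k) := by
  refine zfun_induction (p := fun f => G.conv (G.conv f h) k = G.conv f (G.conv h k))
    f hf (fun U hU => ?_) (by simp only [conv_zero_left])
    (fun f hf f' hf' pf pf' => by
      rw [conv_add_left hf hf', conv_add_left (conv_mem hf hh) (conv_mem hf' hh), pf, pf',
        conv_add_left hf hf'])
    (fun f _ pf => by simp only [conv_neg_left, pf])
  refine zfun_induction (p := fun h => G.conv (G.conv (U.indicator 1) h) k = G.conv (U.indicator 1) (G.conv h k))
    h hh (fun V hV => ?_) (by simp only [conv_zero_left, conv_zero_right])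
    (fun h hh h' hh' ph ph' => by
      rw [conv_add_right hU.mem_zfun, conv_add_left (conv_mem hU.mem_zfun hh)
        (conv_mem hU.mem_zfun hh'), ph, ph', conv_add_left hh hh', conv_add_right hU.mem_zfun])
    (fun h _ ph => by simp only [conv_neg_left, conv_neg_right, ph])
  rw [conv_bis hU.injOn_r]
  ext g
  by_cases h : ∃ a ∈ U, G.r a = G.r g
  · obtain ⟨a, ha, e⟩ := h
    rw [conv_of_mem hU.injOn_r _ ha e]
    set g' := G.mul (G.inv a) g ((G.s_inv a).trans e) with hg'
    by_cases h' : ∃ b ∈ V, G.r b = G.r g'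
    · obtain ⟨b, hb, e'⟩ := h'
      rw [conv_of_mem hV.injOn_r _ hb e']
      have eab : G.s a = G.r b := by rw [e', hg', G.r_mul, G.r_inv]
      have hc : G.mul a b eab ∈ setProd U V :=
        ⟨a, ha, (G.r_mul _ _ _).symm, by rwa [G.inv_mul_cancel_left a b eab]⟩
      have ec : G.r (G.mul a b eab) = G.r g := by rw [G.r_mul, e]
      rw [conv_of_mem (hU.setProd hV).injOn_r _ hc ec]
      congr 1
      have h1 := G.inv_mul_cancel_left (G.mul a b eab)
        (G.mul (G.inv b) g' ((G.s_inv b).trans e')) (by rw [G.s_mul, G.r_mul, G.r_inv])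
      rw [← h1]
      congr 1
      rw [G.mul_assoc a b _ eab (by rw [G.r_mul, G.r_inv])]
      have h2 := G.mul_inv_cancel_left b g' e'
      simp only [h2]
      exact (G.mul_inv_cancel_left a g e).symm
    · push Not at h'
      rw [conv_of_forall _ h', conv_of_forall]
      rintro c ⟨a', ha', e'', hb⟩ hcg
      have h3 := hU.injOn_r ha ha' (by rw [e, e'', hcg])
      subst h3
      exact h' _ hb (by rw [G.r_mul, hg', G.r_mul])
  · push Not at h
    rw [conv_of_forall _ h, conv_of_forall]
    rintro c ⟨a', ha', e'', hb⟩ hcg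
    exact h a' ha' (e''.trans hcg)

variable (G)

/-- The convolution ring `ℤG`. -/
def Alg : Type u := ZFun G.Arr

instance : AddCommGroup G.Alg := inferInstanceAs (AddCommGroup (ZFun G.Arr))

/-- The ring structure of `ℤG`. -/
instance : NonUnitalRing G.Alg where
  __ := (inferInstance : AddCommGroup G.Alg)
  mul f h := ⟨G.conv f.1 h.1, conv_mem f.2 h.2⟩
  left_distrib f h h' := Subtype.ext (conv_add_right f.2 h.1 h'.1)
  right_distrib f f' h := Subtype.ext (conv_add_left f.2 f'.2 h.1)
  zero_mul h := Subtype.ext (conv_zero_left h.1)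
  mul_zero h := Subtype.ext (conv_zero_right h.1)
  mul_assoc f h k := Subtype.ext (conv_assoc f.2 h.2 k.1)

/-- The group `ℤG⁰`. -/
def ZObj : Type u := ZFun G.Obj

instance : AddCommGroup G.ZObj := inferInstanceAs (AddCommGroup (ZFun G.Obj))

theorem isCBis_one {K : Set G.Obj} (ho : IsOpen K) (hc : IsCompact K) :
    G.IsCBis (G.one '' K) where
  isOpen := G.isOpenEmbedding_one.isOpenMap K ho
  isCompact := hc.image G.continuous_one
  injOn_s := by
    rintro _ ⟨x, _, rfl⟩ _ ⟨y, _, rfl⟩ h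
    rw [G.s_one, G.s_one] at h; rw [h]
  injOn_r := by
    rintro _ ⟨x, _, rfl⟩ _ ⟨y, _, rfl⟩ h
    rw [G.r_one, G.r_one] at h; rw [h]

theorem conv_one_left {K : Set G.Obj} (f : G.Arr → ℤ) (hK : ∀ g, f g ≠ 0 → G.r g ∈ K) :
    G.conv ((G.one '' K).indicator 1) f = f := by
  have hinj : Set.InjOn G.r (G.one '' K) := by
    rintro _ ⟨x, _, rfl⟩ _ ⟨y, _, rfl⟩ h
    rw [G.r_one, G.r_one] at h; rw [h]
  ext g
  by_cases hg : G.r g ∈ K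
  · rw [conv_of_mem hinj f (Set.mem_image_of_mem _ hg) (G.r_one _)]
    congr 1
    have h := G.inv_mul_cancel_left (G.one (G.r g)) g (G.s_one _)
    simp only [G.one_mul] at h
    exact h
  · rw [conv_of_forall]
    · by_contra h
      exact hg (hK g (Ne.symm h))
    · rintro _ ⟨x, hx, rfl⟩ h
      rw [G.r_one] at h
      exact hg (h ▸ hx)

theorem conv_one_right {K : Set G.Obj} (f : G.Arr → ℤ) (hK : ∀ g, f g ≠ 0 → G.s g ∈ K) :
    G.conv f ((G.one '' K).indicator 1) = f := by
  ext g
  refine (finsum_eq_single _ ⟨g, rfl⟩ fun a ha => ?_).trans ?_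
  · rw [Set.indicator_of_notMem, mul_zero]
    rintro ⟨x, hx, h⟩
    apply ha
    apply Subtype.ext
    have h1 := G.mul_inv_cancel_left a.1 g a.2
    have h2 : x = G.s a.1 := by
      have := congrArg G.r h
      rwa [G.r_one, G.r_mul, G.r_inv] at this
    subst h2
    simp only [← h] at h1
    rw [G.mul_one] at h1
    exact h1
  · simp only [G.inv_mul]
    by_cases hg : f g = 0
    · simp [hg]
    · rw [Set.indicator_of_mem (Set.mem_image_of_mem _ (hK g hg))]
      simp

theorem exists_compact_support (f : G.Arr → ℤ) (hf : f ∈ ZFun G.Arr) :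
    ∃ K : Set G.Obj, IsOpen K ∧ IsCompact K ∧ ∀ g, f g ≠ 0 → G.s g ∈ K ∧ G.r g ∈ K := by
  refine zfun_induction (p := fun f => ∃ K : Set G.Obj, IsOpen K ∧ IsCompact K ∧ ∀ g, f g ≠ 0 → G.s g ∈ K ∧ G.r g ∈ K)
    f hf (fun B hB => ?_) ⟨∅, isOpen_empty, isCompact_empty, by simp⟩
    (fun f _ h _ pf ph => ?_) (fun f _ pf => by simpa using pf)
  · refine ⟨G.s '' B ∪ G.r '' B, (G.isLocalHomeomorph_s.isOpenMap _ hB.isOpen).union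
      (G.isLocalHomeomorph_r.isOpenMap _ hB.isOpen),
      (hB.isCompact.image G.continuous_s).union (hB.isCompact.image G.continuous_r),
      fun g hg => ?_⟩
    have := Set.mem_of_indicator_ne_zero hg
    exact ⟨Or.inl ⟨g, this, rfl⟩, Or.inr ⟨g, this, rfl⟩⟩
  · obtain ⟨K, ho, hc, hK⟩ := pf
    obtain ⟨K', ho', hc', hK'⟩ := ph
    refine ⟨K ∪ K', ho.union ho', hc.union hc', fun g hg => ?_⟩
    by_cases hfg : f g = 0
    · have : h g ≠ 0 := fun hh => hg (by simp [hfg, hh])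
      exact ⟨Or.inr (hK' g this).1, Or.inr (hK' g this).2⟩
    · exact ⟨Or.inl (hK g hfg).1, Or.inl (hK g hfg).2⟩

instance : HasLocalUnits G.Alg where
  exists_unit t := by
    classical
    have key : ∃ K : Set G.Obj, IsOpen K ∧ IsCompact K ∧
        ∀ f ∈ t, ∀ g, f.1 g ≠ 0 → G.s g ∈ K ∧ G.r g ∈ K := by
      induction t using Finset.induction_on with
      | empty => exact ⟨∅, isOpen_empty, isCompact_empty, by simp⟩
      | insert f t _ ih =>
        obtain ⟨K, ho, hc, hK⟩ := ih
        obtain ⟨K', ho', hc', hK'⟩ := G.exists_compact_support f.1 f.2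
        refine ⟨K ∪ K', ho.union ho', hc.union hc', fun h hh g hg => ?_⟩
        rcases Finset.mem_insert.1 hh with rfl | hh
        · exact ⟨Or.inr (hK' g hg).1, Or.inr (hK' g hg).2⟩
        · exact ⟨Or.inl (hK h hh g hg).1, Or.inl (hK h hh g hg).2⟩
    obtain ⟨K, ho, hc, hK⟩ := key
    refine ⟨⟨_, (G.isCBis_one ho hc).mem_zfun⟩, Subtype.ext (G.conv_one_left _ fun g hg => ?_),
      fun f hf => ⟨Subtype.ext (G.conv_one_left _ fun g hg => (hK f hf g hg).2),
        Subtype.ext (G.conv_one_right _ fun g hg => (hK f hf g hg).1)⟩⟩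
    obtain ⟨x, hx, rfl⟩ := Set.mem_of_indicator_ne_zero hg
    rwa [G.r_one]

/-! ### The trivial modules -/

variable {G}

/-- The right action `(h · f)(x) = ∑_{s(g) = x} h(r(g)) f(g)`. -/
def actR (h : G.Obj → ℤ) (f : G.Arr → ℤ) (x : G.Obj) : ℤ :=
  ∑ᶠ g : {g : G.Arr // G.s g = x}, h (G.r g) * f g

/-- The left action `(f · h)(x) = ∑_{r(g) = x} f(g) h(s(g))`. -/
def actL (f : G.Arr → ℤ) (h : G.Obj → ℤ) (x : G.Obj) : ℤ :=
  ∑ᶠ g : {g : G.Arr // G.r g = x}, f g * h (G.s g)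

theorem actR_support_finite {f : G.Arr → ℤ} (hf : f ∈ ZFun G.Arr) (x : G.Obj)
    (F : {a : G.Arr // G.s a = x} → ℤ) :
    (Function.support fun a : {a : G.Arr // G.s a = x} => F a * f a).Finite := by
  refine ((finite_s_fiber hf x).preimage Subtype.val_injective.injOn).subset ?_
  intro a ha
  exact ⟨a.2, right_ne_zero_of_mul ha⟩

theorem actR_add_left (h h' : G.Obj → ℤ) {f : G.Arr → ℤ} (hf : f ∈ ZFun G.Arr) :
    actR (h + h') f = actR h f + actR h' f := by
  ext x
  refine Eq.trans ?_ (finsum_add_distrib (actR_support_finite hf _ _)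
    (actR_support_finite hf _ _))
  exact finsum_congr fun a => add_mul _ _ _

theorem actR_add_right (h : G.Obj → ℤ) {f f' : G.Arr → ℤ} (hf : f ∈ ZFun G.Arr)
    (hf' : f' ∈ ZFun G.Arr) : actR h (f + f') = actR h f + actR h f' := by
  ext x
  refine Eq.trans ?_ (finsum_add_distrib (actR_support_finite hf _ _)
    (actR_support_finite hf' _ _))
  exact finsum_congr fun a => mul_add _ _ _

theorem actL_add_left {f f' : G.Arr → ℤ} (hf : f ∈ ZFun G.Arr) (hf' : f' ∈ ZFun G.Arr)
    (h : G.Obj → ℤ) : actL (f + f') h = actL f h + actL f' h := by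
  ext x
  refine Eq.trans ?_ (finsum_add_distrib (conv_support_finite hf _ _)
    (conv_support_finite hf' _ _))
  exact finsum_congr fun a => add_mul _ _ _

theorem actL_add_right {f : G.Arr → ℤ} (hf : f ∈ ZFun G.Arr) (h h' : G.Obj → ℤ) :
    actL f (h + h') = actL f h + actL f h' := by
  ext x
  refine Eq.trans ?_ (finsum_add_distrib (conv_support_finite hf _ _)
    (conv_support_finite hf _ _))
  exact finsum_congr fun a => mul_add _ _ _

theorem actR_zero_left (f : G.Arr → ℤ) : actR 0 f = 0 := by ext x; simp [actR]
theorem actR_zero_right (h : G.Obj → ℤ) : actR h (0 : G.Arr → ℤ) = 0 := by ext x; simp [actR]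
theorem actL_zero_left (h : G.Obj → ℤ) : actL (0 : G.Arr → ℤ) h = 0 := by ext x; simp [actL]
theorem actL_zero_right (f : G.Arr → ℤ) : actL f 0 = 0 := by ext x; simp [actL]
theorem actR_neg_left (h : G.Obj → ℤ) (f : G.Arr → ℤ) : actR (-h) f = -actR h f := by
  ext x; simp [actR, finsum_neg_distrib]
theorem actR_neg_right (h : G.Obj → ℤ) (f : G.Arr → ℤ) : actR h (-f) = -actR h f := by
  ext x; simp [actR, finsum_neg_distrib]
theorem actL_neg_left (f : G.Arr → ℤ) (h : G.Obj → ℤ) : actL (-f) h = -actL f h := by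
  ext x; simp [actL, finsum_neg_distrib]
theorem actL_neg_right (f : G.Arr → ℤ) (h : G.Obj → ℤ) : actL f (-h) = -actL f h := by
  ext x; simp [actL, finsum_neg_distrib]

theorem actR_of_mem {B : Set G.Arr} (hB : Set.InjOn G.s B) (h : G.Obj → ℤ) {a : G.Arr}
    (ha : a ∈ B) : actR h (B.indicator 1) (G.s a) = h (G.r a) := by
  refine (finsum_eq_single _ ⟨a, rfl⟩ fun a' ha' => ?_).trans (by simp [ha])
  have : a'.1 ∉ B := fun hm => ha' (Subtype.ext (hB hm ha a'.2))
  simp [this]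

theorem actR_of_forall {B : Set G.Arr} (h : G.Obj → ℤ) {x : G.Obj}
    (hn : ∀ a ∈ B, G.s a ≠ x) : actR h (B.indicator 1) x = 0 := by
  refine finsum_eq_zero_of_forall_eq_zero fun a => ?_
  have : a.1 ∉ B := fun hm => hn _ hm a.2
  simp [this]

theorem actL_of_mem {B : Set G.Arr} (hB : Set.InjOn G.r B) (h : G.Obj → ℤ) {a : G.Arr}
    (ha : a ∈ B) : actL (B.indicator 1) h (G.r a) = h (G.s a) := by
  refine (finsum_eq_single _ ⟨a, rfl⟩ fun a' ha' => ?_).trans (by simp [ha])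
  have : a'.1 ∉ B := fun hm => ha' (Subtype.ext (hB hm ha a'.2))
  simp [this]

theorem actL_of_forall {B : Set G.Arr} (h : G.Obj → ℤ) {x : G.Obj}
    (hn : ∀ a ∈ B, G.r a ≠ x) : actL (B.indicator 1) h x = 0 := by
  refine finsum_eq_zero_of_forall_eq_zero fun a => ?_
  have : a.1 ∉ B := fun hm => hn _ hm a.2
  simp [this]

theorem actR_bis {B : Set G.Arr} (hB : Set.InjOn G.s B) (K : Set G.Obj) :
    actR (K.indicator 1) (B.indicator 1) = (G.s '' (B ∩ G.r ⁻¹' K)).indicator 1 := by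
  ext x
  by_cases h : ∃ a ∈ B, G.s a = x
  · obtain ⟨a, ha, rfl⟩ := h
    rw [actR_of_mem hB _ ha]
    by_cases hm : G.r a ∈ K
    · rw [Set.indicator_of_mem hm, Set.indicator_of_mem (s := G.s '' (B ∩ G.r ⁻¹' K)) ⟨a, ⟨ha, hm⟩, rfl⟩]; rfl
    · rw [Set.indicator_of_notMem hm, Set.indicator_of_notMem]
      rintro ⟨b, ⟨hb, hbK⟩, e⟩
      exact hm (hB hb ha e ▸ hbK)
  · push Not at h
    rw [actR_of_forall _ h, Set.indicator_of_notMem]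
    rintro ⟨a, ⟨ha, -⟩, e⟩
    exact h a ha e

theorem actL_bis {B : Set G.Arr} (hB : Set.InjOn G.r B) (K : Set G.Obj) :
    actL (B.indicator 1) (K.indicator 1) = (G.r '' (B ∩ G.s ⁻¹' K)).indicator 1 := by
  ext x
  by_cases h : ∃ a ∈ B, G.r a = x
  · obtain ⟨a, ha, rfl⟩ := h
    rw [actL_of_mem hB _ ha]
    by_cases hm : G.s a ∈ K
    · rw [Set.indicator_of_mem hm, Set.indicator_of_mem (s := G.r '' (B ∩ G.s ⁻¹' K)) ⟨a, ⟨ha, hm⟩, rfl⟩]; rfl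
    · rw [Set.indicator_of_notMem hm, Set.indicator_of_notMem]
      rintro ⟨b, ⟨hb, hbK⟩, e⟩
      exact hm (hB hb ha e ▸ hbK)
  · push Not at h
    rw [actL_of_forall _ h, Set.indicator_of_notMem]
    rintro ⟨a, ⟨ha, -⟩, e⟩
    exact h a ha e

theorem zfun_obj_induction (h : G.Obj → ℤ) (hh : h ∈ ZFun G.Obj) {p : (G.Obj → ℤ) → Prop}
    (ind : ∀ K : Set G.Obj, IsOpen K → IsCompact K → p (K.indicator 1))
    (zero : p 0) (add : ∀ f ∈ ZFun G.Obj, ∀ h ∈ ZFun G.Obj, p f → p h → p (f + h))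
    (neg : ∀ f ∈ ZFun G.Obj, p f → p (-f)) : p h := by
  induction hh using AddSubgroup.closure_induction with
  | mem f h => obtain ⟨B, ho, hc, -, rfl⟩ := h; exact ind B ho hc
  | zero => exact zero
  | add f h hf hh pf ph => exact add f hf h hh pf ph
  | neg f hf pf => exact neg f hf pf

theorem mem_zfun_obj {K : Set G.Obj} (ho : IsOpen K) (hc : IsCompact K) :
    K.indicator 1 ∈ ZFun G.Obj :=
  AddSubgroup.subset_closure ⟨K, ho, hc, inferInstance, rfl⟩

theorem actR_mem {h : G.Obj → ℤ} {f : G.Arr → ℤ} (hh : h ∈ ZFun G.Obj) (hf : f ∈ ZFun G.Arr) :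
    actR h f ∈ ZFun G.Obj := by
  refine zfun_obj_induction (p := fun h => actR h f ∈ ZFun G.Obj) h hh (fun K ho hc => ?_)
    (by rw [actR_zero_left]; exact zero_mem _)
    (fun h _ h' _ ph ph' => by rw [actR_add_left _ _ hf]; exact add_mem ph ph')
    (fun h _ ph => by rw [actR_neg_left]; exact neg_mem ph)
  refine zfun_induction (p := fun f => actR (K.indicator 1) f ∈ ZFun G.Obj) f hf (fun B hB => ?_)
    (by rw [actR_zero_right]; exact zero_mem _)
    (fun f hf f' hf' pf pf' => by rw [actR_add_right _ hf hf']; exact add_mem pf pf')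
    (fun f _ pf => by rw [actR_neg_right]; exact neg_mem pf)
  rw [actR_bis hB.injOn_s]
  have := hB.t2Space
  have ho' : IsOpen (B ∩ G.r ⁻¹' K) := hB.isOpen.inter (ho.preimage G.continuous_r)
  exact mem_zfun_obj (G.isLocalHomeomorph_s.isOpenMap _ ho')
    ((hB.isCompact.inter_right (hc.isClosed.preimage G.continuous_r)).image G.continuous_s)

theorem actL_mem {f : G.Arr → ℤ} {h : G.Obj → ℤ} (hf : f ∈ ZFun G.Arr) (hh : h ∈ ZFun G.Obj) :
    actL f h ∈ ZFun G.Obj := by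
  refine zfun_obj_induction (p := fun h => actL f h ∈ ZFun G.Obj) h hh (fun K ho hc => ?_)
    (by rw [actL_zero_right]; exact zero_mem _)
    (fun h _ h' _ ph ph' => by rw [actL_add_right hf]; exact add_mem ph ph')
    (fun h _ ph => by rw [actL_neg_right]; exact neg_mem ph)
  refine zfun_induction (p := fun f => actL f (K.indicator 1) ∈ ZFun G.Obj) f hf (fun B hB => ?_)
    (by rw [actL_zero_left]; exact zero_mem _)
    (fun f hf f' hf' pf pf' => by rw [actL_add_left hf hf']; exact add_mem pf pf')
    (fun f _ pf => by rw [actL_neg_left]; exact neg_mem pf)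
  rw [actL_bis hB.injOn_r]
  have ho' : IsOpen (B ∩ G.s ⁻¹' K) := hB.isOpen.inter (ho.preimage G.continuous_s)
  exact mem_zfun_obj (G.isLocalHomeomorph_r.isOpenMap _ ho')
    ((hB.isCompact.inter_right (hc.isClosed.preimage G.continuous_s)).image G.continuous_r)

theorem actR_actR (h : G.Obj → ℤ) {f k : G.Arr → ℤ} (hf : f ∈ ZFun G.Arr)
    (hk : k ∈ ZFun G.Arr) : actR (actR h f) k = actR h (G.conv f k) := by
  refine zfun_induction (p := fun f => actR (actR h f) k = actR h (G.conv f k)) f hf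
    (fun U hU => ?_)
    (by simp only [actR_zero_right, actR_zero_left, conv_zero_left])
    (fun f hf f' hf' pf pf' => by
      rw [actR_add_right _ hf hf', actR_add_left _ _ hk, pf, pf', conv_add_left hf hf',
        actR_add_right _ (conv_mem hf hk) (conv_mem hf' hk)])
    (fun f _ pf => by rw [actR_neg_right, actR_neg_left, pf, conv_neg_left, actR_neg_right])
  refine zfun_induction (p := fun k => actR (actR h (U.indicator 1)) k =
    actR h (G.conv (U.indicator 1) k)) k hk (fun V hV => ?_)
    (by simp only [actR_zero_right, conv_zero_right])
    (fun k hk k' hk' pk pk' => by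
      rw [actR_add_right _ hk hk', pk, pk', conv_add_right hU.mem_zfun,
        actR_add_right _ (conv_mem hU.mem_zfun hk) (conv_mem hU.mem_zfun hk')])
    (fun k _ pk => by rw [actR_neg_right, pk, conv_neg_right, actR_neg_right])
  rw [conv_bis hU.injOn_r]
  ext x
  by_cases hx : ∃ b ∈ V, G.s b = x
  · obtain ⟨b, hb, rfl⟩ := hx
    rw [actR_of_mem hV.injOn_s _ hb]
    by_cases ha : ∃ a ∈ U, G.s a = G.r b
    · obtain ⟨a, ha, e⟩ := ha
      have h1 := actR_of_mem (hU.setProd hV).injOn_s h (a := G.mul a b e)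
        ⟨a, ha, (G.r_mul _ _ _).symm, by rwa [G.inv_mul_cancel_left a b e]⟩
      rw [G.s_mul, G.r_mul] at h1
      rw [h1, ← e, actR_of_mem hU.injOn_s _ ha]
    · push Not at ha
      rw [actR_of_forall _ ha, actR_of_forall]
      rintro c ⟨a, haU, e, hm⟩ hc
      have := hV.injOn_s hm hb (by rw [G.s_mul, hc])
      exact ha a haU (by rw [← this, G.r_mul, G.r_inv])
  · push Not at hx
    rw [actR_of_forall _ hx, actR_of_forall]
    rintro c ⟨a, haU, e, hm⟩ hc
    exact hx _ hm (by rw [G.s_mul, hc])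

theorem actL_actL {f k : G.Arr → ℤ} (hf : f ∈ ZFun G.Arr)
    (hk : k ∈ ZFun G.Arr) (h : G.Obj → ℤ) : actL (G.conv f k) h = actL f (actL k h) := by
  refine zfun_induction (p := fun f => actL (G.conv f k) h = actL f (actL k h)) f hf
    (fun U hU => ?_)
    (by simp only [actL_zero_left, conv_zero_left])
    (fun f hf f' hf' pf pf' => by
      rw [conv_add_left hf hf', actL_add_left (conv_mem hf hk) (conv_mem hf' hk), pf, pf',
        actL_add_left hf hf'])
    (fun f _ pf => by rw [conv_neg_left, actL_neg_left, pf, actL_neg_left])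
  refine zfun_induction (p := fun k => actL (G.conv (U.indicator 1) k) h =
    actL (U.indicator 1) (actL k h)) k hk (fun V hV => ?_)
    (by simp only [actL_zero_left, actL_zero_right, conv_zero_right])
    (fun k hk k' hk' pk pk' => by
      rw [conv_add_right hU.mem_zfun, actL_add_left (conv_mem hU.mem_zfun hk)
        (conv_mem hU.mem_zfun hk'), pk, pk', actL_add_left hk hk', actL_add_right hU.mem_zfun])
    (fun k _ pk => by rw [conv_neg_right, actL_neg_left, pk, actL_neg_left, actL_neg_right])
  rw [conv_bis hU.injOn_r]
  ext x
  by_cases hx : ∃ a ∈ U, G.r a = x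
  · obtain ⟨a, ha, rfl⟩ := hx
    rw [actL_of_mem hU.injOn_r _ ha]
    by_cases hb : ∃ b ∈ V, G.r b = G.s a
    · obtain ⟨b, hb, e⟩ := hb
      have h1 := actL_of_mem (hU.setProd hV).injOn_r h (a := G.mul a b e.symm)
        ⟨a, ha, (G.r_mul _ _ _).symm, by rwa [G.inv_mul_cancel_left a b e.symm]⟩
      rw [G.s_mul, G.r_mul] at h1
      rw [h1, ← e, actL_of_mem hV.injOn_r _ hb]
    · push Not at hb
      rw [actL_of_forall _ hb, actL_of_forall]
      rintro c ⟨a', haU, e, hm⟩ hc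
      have := hU.injOn_r haU ha (by rw [e, hc])
      subst this
      exact hb _ hm (by rw [G.r_mul, G.r_inv])
  · push Not at hx
    rw [actL_of_forall _ hx, actL_of_forall]
    rintro c ⟨a, haU, e, hm⟩ hc
    exact hx a haU (e.trans hc)

variable (G)

/-- `ℤG⁰` as a left `ℤG`-module. -/
instance : RngModule G.Alg G.ZObj where
  smul f h := ⟨actL f.1 h.1, actL_mem f.2 h.2⟩
  smul_add f h h' := Subtype.ext (actL_add_right f.2 h.1 h'.1)
  add_smul f f' h := Subtype.ext (actL_add_left f.2 f'.2 h.1)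
  mul_smul f k h := Subtype.ext (actL_actL f.2 k.2 h.1)

/-- `ℤG⁰` as a right `ℤG`-module. -/
instance : RngModule G.Algᵐᵒᵖ G.ZObj where
  smul f h := ⟨actR h.1 f.unop.1, actR_mem h.2 f.unop.2⟩
  smul_add f h h' := Subtype.ext (actR_add_left h.1 h'.1 f.unop.2)
  add_smul f f' h := Subtype.ext (actR_add_right h.1 f.unop.2 f'.unop.2)
  mul_smul f k h := Subtype.ext (actR_actR h.1 k.unop.2 f.unop.2).symm

/-- The trivial right module `ℤG⁰`. -/
def trivialRight : UnitaryRightModule G.Alg where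
  carrier := G.ZObj
  unitary := UnitaryRightModule.isUnitary_of_forall fun h => by
    have key : ∃ K : Set G.Obj, IsOpen K ∧ IsCompact K ∧ ∀ x, h.1 x ≠ 0 → x ∈ K := by
      refine zfun_obj_induction (p := fun h => ∃ K : Set G.Obj, IsOpen K ∧ IsCompact K ∧
        ∀ x, h x ≠ 0 → x ∈ K) h.1 h.2
        (fun K ho hc => ⟨K, ho, hc, fun x hx => Set.mem_of_indicator_ne_zero hx⟩)
        ⟨∅, isOpen_empty, isCompact_empty, by simp⟩ ?_ (fun f _ pf => by simpa using pf)
      rintro f _ f' _ ⟨K, ho, hc, hK⟩ ⟨K', ho', hc', hK'⟩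
      refine ⟨K ∪ K', ho.union ho', hc.union hc', fun x hx => ?_⟩
      by_cases hfx : f x = 0
      · exact Or.inr (hK' x fun hh => hx (by simp [hfx, hh]))
      · exact Or.inl (hK x hfx)
    obtain ⟨K, ho, hc, hK⟩ := key
    refine ⟨⟨_, (G.isCBis_one ho hc).mem_zfun⟩, Subtype.ext ?_⟩
    change actR h.1 ((G.one '' K).indicator 1) = h.1
    ext x
    by_cases hx : x ∈ K
    · have := actR_of_mem (G.isCBis_one ho hc).injOn_s h.1 (Set.mem_image_of_mem _ hx)
      rwa [G.s_one, G.r_one] at this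
    · rw [actR_of_forall]
      · by_contra hne
        exact hx (hK x (Ne.symm hne))
      · rintro _ ⟨y, hy, rfl⟩ e
        rw [G.s_one] at e
        exact hx (e ▸ hy)

/-! ### Homology -/

/-- `H_n(G, M) = Tor_n^{ℤG}(ℤG⁰, M)`. -/
abbrev Homology (n : ℕ) (M : Type v) [AddCommGroup M] [RngModule G.Alg M] : Type (max u v) :=
  UnitaryRightModule.Tor M n G.trivialRight

/-! ### Open embeddings of groupoids and open subgroupoids -/

/-- Open topological embeddings of groupoids which preserve the structure. -/
structure OpenEmb (H G : AmpleGroupoid.{u}) where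
  arr : H.Arr → G.Arr
  obj : H.Obj → G.Obj
  isOpenEmbedding_arr : Topology.IsOpenEmbedding arr
  isOpenEmbedding_obj : Topology.IsOpenEmbedding obj
  s_arr : ∀ g, G.s (arr g) = obj (H.s g)
  r_arr : ∀ g, G.r (arr g) = obj (H.r g)
  arr_mul : ∀ g h e, arr (H.mul g h e) =
    G.mul (arr g) (arr h) ((s_arr g).trans ((congrArg obj e).trans (r_arr h).symm))

/-- Extension by zero along an injective map. -/
def extendZero {X Y : Type u} (ι : X → Y) (hι : Function.Injective ι) : (X → ℤ) →+ (Y → ℤ) :=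
  AddMonoidHom.mk' (fun f => Function.extend ι f (0 : Y → ℤ)) fun f f' => by
    ext y
    by_cases h : ∃ x, ι x = y
    · obtain ⟨x, rfl⟩ := h
      simp [hι.extend_apply]
    · simp [Function.extend_apply' _ _ _ h]

theorem extendZero_indicator {X Y : Type u} (ι : X → Y) (hι : Function.Injective ι) (U : Set X) :
    extendZero ι hι (U.indicator 1) = (ι '' U).indicator 1 := by
  ext y
  change Function.extend ι _ (0 : Y → ℤ) y = _
  by_cases h : ∃ x, ι x = y
  · obtain ⟨x, rfl⟩ := h
    rw [hι.extend_apply]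
    by_cases hx : x ∈ U
    · rw [Set.indicator_of_mem hx, Set.indicator_of_mem (Set.mem_image_of_mem _ hx)]; rfl
    · rw [Set.indicator_of_notMem hx, Set.indicator_of_notMem]
      rintro ⟨x', hx', e⟩
      exact hx (hι e ▸ hx')
  · rw [Function.extend_apply' _ _ _ h, Set.indicator_of_notMem]
    · rfl
    · rintro ⟨x, -, e⟩
      exact h ⟨x, e⟩

theorem extendZero_mem {X Y : Type u} [TopologicalSpace X] [TopologicalSpace Y] {ι : X → Y}
    (hι : Topology.IsOpenEmbedding ι) {f : X → ℤ} (hf : f ∈ ZFun X) :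
    extendZero ι hι.injective f ∈ ZFun Y := by
  have : ZFun X ≤ (ZFun Y).comap (extendZero ι hι.injective) := by
    refine (AddSubgroup.closure_le _).2 ?_
    rintro _ ⟨U, ho, hc, h2, rfl⟩
    refine AddSubgroup.subset_closure ⟨ι '' U, hι.isOpenMap U ho, hc.image hι.continuous, ?_,
      extendZero_indicator _ _ _⟩
    exact (hι.isEmbedding.homeomorphImage U).t2Space
  exact this hf

/-- Extension by zero `ℤX → ℤY` along an open embedding `X → Y`. -/
def zfunMap {X Y : Type u} [TopologicalSpace X] [TopologicalSpace Y] {ι : X → Y}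
    (hι : Topology.IsOpenEmbedding ι) : ZFun X →+ ZFun Y :=
  ((extendZero ι hι.injective).comp (ZFun X).subtype).codRestrict (ZFun Y)
    fun f => extendZero_mem hι f.2

namespace OpenEmb

variable {H G : AmpleGroupoid.{u}} (ι : OpenEmb H G)

theorem image_setProd (U V : Set H.Arr) :
    ι.arr '' setProd U V = setProd (ι.arr '' U) (ι.arr '' V) := by
  rw [setProd_eq_image, setProd_eq_image]
  ext g
  constructor
  · rintro ⟨_, ⟨⟨⟨a, b⟩, e⟩, ⟨ha, hb⟩, rfl⟩, rfl⟩
    exact ⟨⟨(ι.arr a, ι.arr b), (ι.s_arr a).trans ((congrArg ι.obj e).trans (ι.r_arr b).symm)⟩, ⟨Set.mem_image_of_mem _ ha, Set.mem_image_of_mem _ hb⟩,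
      (ι.arr_mul a b e).symm⟩
  · rintro ⟨⟨⟨_, _⟩, e⟩, ⟨⟨a, ha, rfl⟩, ⟨b, hb, rfl⟩⟩, rfl⟩
    have e' : H.s a = H.r b := by
      apply ι.isOpenEmbedding_obj.injective
      rw [← ι.s_arr, ← ι.r_arr]; exact e
    exact ⟨_, ⟨⟨(a, b), e'⟩, ⟨ha, hb⟩, rfl⟩, ι.arr_mul a b e'⟩

theorem image_cbis {U : Set H.Arr} (hU : H.IsCBis U) : G.IsCBis (ι.arr '' U) where
  isOpen := ι.isOpenEmbedding_arr.isOpenMap U hU.isOpen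
  isCompact := hU.isCompact.image ι.isOpenEmbedding_arr.continuous
  injOn_s := by
    rintro _ ⟨a, ha, rfl⟩ _ ⟨b, hb, rfl⟩ h
    rw [ι.s_arr, ι.s_arr] at h
    rw [hU.injOn_s ha hb (ι.isOpenEmbedding_obj.injective h)]
  injOn_r := by
    rintro _ ⟨a, ha, rfl⟩ _ ⟨b, hb, rfl⟩ h
    rw [ι.r_arr, ι.r_arr] at h
    rw [hU.injOn_r ha hb (ι.isOpenEmbedding_obj.injective h)]

/-- Extension by zero of functions on arrows. -/
abbrev extArr : (H.Arr → ℤ) →+ (G.Arr → ℤ) := extendZero ι.arr ι.isOpenEmbedding_arr.injective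

theorem ext_conv {f k : H.Arr → ℤ} (hf : f ∈ ZFun H.Arr) (hk : k ∈ ZFun H.Arr) :
    ι.extArr (H.conv f k) = G.conv (ι.extArr f) (ι.extArr k) := by
  refine zfun_induction (p := fun f => ι.extArr (H.conv f k) = G.conv (ι.extArr f) (ι.extArr k)) f hf
    (fun U hU => ?_)
    (by simp only [extArr, conv_zero_left, map_zero])
    (fun f hf f' hf' pf pf' => by
      rw [conv_add_left hf hf', map_add, pf, pf', map_add,
        conv_add_left (extendZero_mem ι.isOpenEmbedding_arr hf) (extendZero_mem ι.isOpenEmbedding_arr hf')])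
    (fun f _ pf => by rw [conv_neg_left, map_neg, pf, map_neg, conv_neg_left])
  have hU' := ι.image_cbis hU
  refine zfun_induction (p := fun k => ι.extArr (H.conv (U.indicator 1) k) =
    G.conv (ι.extArr (U.indicator 1)) (ι.extArr k)) k hk
    (fun V hV => ?_)
    (by simp only [extArr, conv_zero_right, map_zero])
    (fun k _ k' _ pf pf' => by
      rw [conv_add_right hU.mem_zfun, map_add, pf, pf', map_add,
        conv_add_right (extendZero_mem ι.isOpenEmbedding_arr hU.mem_zfun)])
    (fun f _ pf => by rw [conv_neg_right, map_neg, pf, map_neg, conv_neg_right])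
  rw [conv_bis hU.injOn_r, extArr, extendZero_indicator, extendZero_indicator,
    extendZero_indicator, conv_bis hU'.injOn_r, image_setProd]

/-- The ring homomorphism `ℤH → ℤG`, extension by zero. -/
def algMap : H.Alg →ₙ+* G.Alg where
  toFun f := zfunMap ι.isOpenEmbedding_arr f
  map_zero' := (zfunMap ι.isOpenEmbedding_arr).map_zero
  map_add' f f' := (zfunMap ι.isOpenEmbedding_arr).map_add f f'
  map_mul' f f' := Subtype.ext (ι.ext_conv f.2 f'.2)

/-- Extension by zero `ℤH⁰ → ℤG⁰`. -/
def objMap : H.ZObj →+ G.ZObj := zfunMap ι.isOpenEmbedding_obj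

/-- Extension by zero of functions on objects. -/
abbrev extObj : (H.Obj → ℤ) →+ (G.Obj → ℤ) := extendZero ι.obj ι.isOpenEmbedding_obj.injective

theorem image_s (U : Set H.Arr) (K : Set H.Obj) : ι.obj '' (H.s '' (U ∩ H.r ⁻¹' K)) =
    G.s '' (ι.arr '' U ∩ G.r ⁻¹' (ι.obj '' K)) := by
  ext x
  constructor
  · rintro ⟨_, ⟨a, ⟨ha, haK⟩, rfl⟩, rfl⟩
    exact ⟨ι.arr a, ⟨⟨a, ha, rfl⟩, ⟨H.r a, haK, (ι.r_arr a).symm⟩⟩, ι.s_arr a⟩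
  · rintro ⟨_, ⟨⟨a, ha, rfl⟩, ⟨y, hy, e⟩⟩, rfl⟩
    rw [ι.r_arr] at e
    have := ι.isOpenEmbedding_obj.injective e
    subst this
    exact ⟨_, ⟨a, ⟨ha, hy⟩, rfl⟩, (ι.s_arr a).symm⟩

theorem image_r (U : Set H.Arr) (K : Set H.Obj) : ι.obj '' (H.r '' (U ∩ H.s ⁻¹' K)) =
    G.r '' (ι.arr '' U ∩ G.s ⁻¹' (ι.obj '' K)) := by
  ext x
  constructor
  · rintro ⟨_, ⟨a, ⟨ha, haK⟩, rfl⟩, rfl⟩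
    exact ⟨ι.arr a, ⟨⟨a, ha, rfl⟩, ⟨H.s a, haK, (ι.s_arr a).symm⟩⟩, ι.r_arr a⟩
  · rintro ⟨_, ⟨⟨a, ha, rfl⟩, ⟨y, hy, e⟩⟩, rfl⟩
    rw [ι.s_arr] at e
    have := ι.isOpenEmbedding_obj.injective e
    subst this
    exact ⟨_, ⟨a, ⟨ha, hy⟩, rfl⟩, (ι.r_arr a).symm⟩

theorem ext_actR {h : H.Obj → ℤ} {f : H.Arr → ℤ} (hh : h ∈ ZFun H.Obj) (hf : f ∈ ZFun H.Arr) :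
    ι.extObj (actR h f) = actR (ι.extObj h) (ι.extArr f) := by
  refine zfun_obj_induction (p := fun h => ι.extObj (actR h f) = actR (ι.extObj h) (ι.extArr f)) h hh
    (fun K ho hc => ?_)
    (by simp only [extObj, actR_zero_left, map_zero])
    (fun h _ h' _ ph ph' => by
      rw [actR_add_left _ _ hf, map_add, ph, ph', map_add,
        actR_add_left _ _ (extendZero_mem ι.isOpenEmbedding_arr hf)])
    (fun h _ ph => by rw [actR_neg_left, map_neg, ph, map_neg, actR_neg_left])
  refine zfun_induction (p := fun f => ι.extObj (actR (K.indicator 1) f) =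
    actR (ι.extObj (K.indicator 1)) (ι.extArr f)) f hf
    (fun U hU => ?_)
    (by simp only [extArr, extObj, actR_zero_right, map_zero])
    (fun f hf f' hf' pf pf' => by
      rw [actR_add_right _ hf hf', map_add, pf, pf', map_add,
        actR_add_right _ (extendZero_mem ι.isOpenEmbedding_arr hf) (extendZero_mem ι.isOpenEmbedding_arr hf')])
    (fun f _ pf => by rw [actR_neg_right, map_neg, pf, map_neg, actR_neg_right])
  rw [actR_bis hU.injOn_s, extObj, extArr, extendZero_indicator, extendZero_indicator,
    extendZero_indicator, actR_bis (ι.image_cbis hU).injOn_s, image_s]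

theorem ext_actL {h : H.Obj → ℤ} {f : H.Arr → ℤ} (hf : f ∈ ZFun H.Arr) (hh : h ∈ ZFun H.Obj) :
    ι.extObj (actL f h) = actL (ι.extArr f) (ι.extObj h) := by
  refine zfun_obj_induction (p := fun h => ι.extObj (actL f h) = actL (ι.extArr f) (ι.extObj h)) h hh
    (fun K ho hc => ?_)
    (by simp only [extObj, actL_zero_right, map_zero])
    (fun h _ h' _ ph ph' => by
      rw [actL_add_right hf, map_add, ph, ph', map_add,
        actL_add_right (extendZero_mem ι.isOpenEmbedding_arr hf)])
    (fun h _ ph => by rw [actL_neg_right, map_neg, ph, map_neg, actL_neg_right])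
  refine zfun_induction (p := fun f => ι.extObj (actL f (K.indicator 1)) =
    actL (ι.extArr f) (ι.extObj (K.indicator 1))) f hf
    (fun U hU => ?_)
    (by simp only [extArr, extObj, actL_zero_left, map_zero])
    (fun f hf f' hf' pf pf' => by
      rw [actL_add_left hf hf', map_add, pf, pf', map_add,
        actL_add_left (extendZero_mem ι.isOpenEmbedding_arr hf) (extendZero_mem ι.isOpenEmbedding_arr hf')])
    (fun f _ pf => by rw [actL_neg_left, map_neg, pf, map_neg, actL_neg_left])
  rw [actL_bis hU.injOn_r, extObj, extArr, extendZero_indicator, extendZero_indicator,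
    extendZero_indicator, actL_bis (ι.image_cbis hU).injOn_r, image_r]

theorem objMap_smul (f : H.Alg) (h : H.ZObj) : ι.objMap (f • h) = ι.algMap f • ι.objMap h :=
  Subtype.ext (ι.ext_actL f.2 h.2)

/-- The map of trivial right modules `ℤH⁰ → ℤG⁰`. -/
def trivialMap : UnitaryRightModule.SemiHom ι.algMap H.trivialRight G.trivialRight where
  toAddMonoidHom := ι.objMap
  map_smul f h := Subtype.ext (ι.ext_actR (f := f.1) (h := (h : H.ZObj).1) h.2 f.2)

/-- The map `H_n(H, M) → H_n(G, M')` induced by an open embedding `H → G` and a compatible map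
of coefficients `M → M'`. -/
def homologyMap {M : Type v} [AddCommGroup M] [RngModule H.Alg M]
    {M' : Type v} [AddCommGroup M'] [RngModule G.Alg M'] (β : M →+ M')
    (hβ : ∀ (f : H.Alg) (m : M), β (f • m) = ι.algMap f • β m) (n : ℕ) :
    H.Homology n M →+ G.Homology n M' :=
  UnitaryRightModule.Tor.map ι.trivialMap β hβ n

variable (M : Type v) [AddCommGroup M] [RngModule G.Alg M]

/-- The subgroup `ℤH · M` of a `ℤG`-module `M`. -/
def resGroup : AddSubgroup M :=
  AddSubgroup.closure {m | ∃ (f : H.Alg) (m' : M), m = ι.algMap f • m'}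

theorem smul_mem_resGroup (f : H.Alg) (m : M) : ι.algMap f • m ∈ ι.resGroup M :=
  AddSubgroup.subset_closure ⟨f, m, rfl⟩

/-- The `ℤH`-module `ℤH · M`. -/
instance : RngModule H.Alg (ι.resGroup M) where
  smul f m := ⟨ι.algMap f • m.1, ι.smul_mem_resGroup M f m.1⟩
  smul_add f m m' := Subtype.ext (RngModule.smul_add _ m.1 m'.1)
  add_smul f f' m := Subtype.ext (by
    change ι.algMap (f + f') • m.1 = ι.algMap f • m.1 + ι.algMap f' • m.1
    rw [map_add, RngModule.add_smul])
  mul_smul f f' m := Subtype.ext (by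
    change ι.algMap (f * f') • m.1 = ι.algMap f • (ι.algMap f' • m.1)
    rw [map_mul, RngModule.mul_smul])

end OpenEmb

/-- An open subgroupoid: an open set of arrows closed under products and inverses.  It need not
contain all units of `G`, and its unit space is the set of units of `G` which it contains. -/
structure OpenSubgroupoid where
  carrier : Set G.Arr
  isOpen : IsOpen carrier
  mul_mem : ∀ g ∈ carrier, ∀ h ∈ carrier, ∀ e : G.s g = G.r h, G.mul g h e ∈ carrier
  inv_mem : ∀ g ∈ carrier, G.inv g ∈ carrier

namespace OpenSubgroupoid

variable {G}

theorem one_s_mem (H : G.OpenSubgroupoid) {g : G.Arr} (hg : g ∈ H.carrier) :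
    G.one (G.s g) ∈ H.carrier := by
  rw [← G.inv_mul]
  exact H.mul_mem _ (H.inv_mem g hg) _ hg _

theorem one_r_mem (H : G.OpenSubgroupoid) {g : G.Arr} (hg : g ∈ H.carrier) :
    G.one (G.r g) ∈ H.carrier := by
  rw [← G.mul_inv]
  exact H.mul_mem _ hg _ (H.inv_mem g hg) _

/-- An open subgroupoid as an ample groupoid with the subspace topologies. -/
def toGroupoid (H : G.OpenSubgroupoid) : AmpleGroupoid.{u} where
  Obj := {x : G.Obj // G.one x ∈ H.carrier}
  Arr := {g : G.Arr // g ∈ H.carrier}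
  s g := ⟨G.s g, H.one_s_mem g.2⟩
  r g := ⟨G.r g, H.one_r_mem g.2⟩
  one x := ⟨G.one x, x.2⟩
  inv g := ⟨G.inv g, H.inv_mem _ g.2⟩
  mul g h e := ⟨G.mul g h (congrArg Subtype.val e), H.mul_mem _ g.2 _ h.2 _⟩
  s_one x := Subtype.ext (G.s_one x)
  r_one x := Subtype.ext (G.r_one x)
  s_inv g := Subtype.ext (G.s_inv g)
  r_inv g := Subtype.ext (G.r_inv g)
  s_mul g h e := Subtype.ext (G.s_mul g h _)
  r_mul g h e := Subtype.ext (G.r_mul g h _)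
  mul_assoc g h k e e' := Subtype.ext (G.mul_assoc g h k _ _)
  one_mul g := Subtype.ext (G.one_mul g)
  mul_one g := Subtype.ext (G.mul_one g)
  inv_mul g := Subtype.ext (G.inv_mul g)
  mul_inv g := Subtype.ext (G.mul_inv g)
  continuous_s := (G.continuous_s.comp continuous_subtype_val).subtype_mk _
  continuous_r := (G.continuous_r.comp continuous_subtype_val).subtype_mk _
  continuous_one := (G.continuous_one.comp continuous_subtype_val).subtype_mk _
  continuous_inv := (G.continuous_inv.comp continuous_subtype_val).subtype_mk _
  continuous_mul := by
    refine Continuous.subtype_mk ?_ _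
    refine G.continuous_mul.comp (f := fun p : {p : H.carrier × H.carrier //
      (⟨G.s p.1, H.one_s_mem p.1.2⟩ : {x : G.Obj // G.one x ∈ H.carrier}) =
        ⟨G.r p.2, H.one_r_mem p.2.2⟩} =>
      (⟨(p.1.1.1, p.1.2.1), congrArg Subtype.val p.2⟩ :
        {p : G.Arr × G.Arr // G.s p.1 = G.r p.2})) ?_
    fun_prop
  locallyCompact := (H.isOpen.preimage G.continuous_one).locallyCompactSpace
  t2 := inferInstance
  totallyDisconnected := inferInstance
  isLocalHomeomorph_s := by
    refine IsLocalHomeomorph.of_comp (g := Subtype.val)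
      (G.isLocalHomeomorph_s.comp H.isOpen.isOpenEmbedding_subtypeVal.isLocalHomeomorph)
      (H.isOpen.preimage G.continuous_one).isOpenEmbedding_subtypeVal.isLocalHomeomorph
      ((G.continuous_s.comp continuous_subtype_val).subtype_mk _)

/-- The inclusion of an open subgroupoid. -/
def incl (H : G.OpenSubgroupoid) : OpenEmb H.toGroupoid G where
  arr := Subtype.val
  obj := Subtype.val
  isOpenEmbedding_arr := H.isOpen.isOpenEmbedding_subtypeVal
  isOpenEmbedding_obj := (H.isOpen.preimage G.continuous_one).isOpenEmbedding_subtypeVal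
  s_arr _ := rfl
  r_arr _ := rfl
  arr_mul _ _ _ := rfl

/-- The inclusion of one open subgroupoid in another. -/
def inclusion {H K : G.OpenSubgroupoid} (h : H.carrier ⊆ K.carrier) :
    OpenEmb H.toGroupoid K.toGroupoid where
  arr := Set.inclusion h
  obj x := ⟨x.1, h x.2⟩
  isOpenEmbedding_arr := Topology.IsOpenEmbedding.of_comp (Set.inclusion h)
    K.isOpen.isOpenEmbedding_subtypeVal H.isOpen.isOpenEmbedding_subtypeVal
  isOpenEmbedding_obj := Topology.IsOpenEmbedding.of_comp
    (fun x : {x : G.Obj // G.one x ∈ H.carrier} =>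
      (⟨x.1, h x.2⟩ : {x : G.Obj // G.one x ∈ K.carrier}))
    (K.isOpen.preimage G.continuous_one).isOpenEmbedding_subtypeVal
    (H.isOpen.preimage G.continuous_one).isOpenEmbedding_subtypeVal
  s_arr _ := rfl
  r_arr _ := rfl
  arr_mul _ _ _ := rfl

theorem algMap_inclusion {H K : G.OpenSubgroupoid} (h : H.carrier ⊆ K.carrier)
    (f : H.toGroupoid.Alg) : K.incl.algMap ((inclusion h).algMap f) = H.incl.algMap f := by
  refine Subtype.ext (funext fun g => ?_)
  change Function.extend (Subtype.val : K.carrier → G.Arr)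
    (Function.extend (Set.inclusion h) f.1 (0 : K.carrier → ℤ)) (0 : G.Arr → ℤ) g =
    Function.extend (Subtype.val : H.carrier → G.Arr) f.1 (0 : G.Arr → ℤ) g
  by_cases hg : g ∈ H.carrier
  · have e1 := Subtype.val_injective.extend_apply
      (Function.extend (Set.inclusion h) f.1 (0 : K.carrier → ℤ)) (0 : G.Arr → ℤ) (⟨g, h hg⟩ : K.carrier)
    have e2 := (Set.inclusion_injective h).extend_apply f.1 (0 : K.carrier → ℤ) ⟨g, hg⟩
    have e3 := Subtype.val_injective.extend_apply f.1 (0 : G.Arr → ℤ) (⟨g, hg⟩ : H.carrier)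
    exact e1.trans (e2.trans e3.symm)
  · rw [Function.extend_apply' (f := Subtype.val) f.1 (0 : G.Arr → ℤ) g (by
      rintro ⟨x, rfl⟩; exact hg x.2)]
    by_cases hgK : g ∈ K.carrier
    · have e1 := Subtype.val_injective.extend_apply
        (Function.extend (Set.inclusion h) f.1 (0 : K.carrier → ℤ)) (0 : G.Arr → ℤ) (⟨g, hgK⟩ : K.carrier)
      refine e1.trans (Function.extend_apply' _ _ _ ?_)
      rintro ⟨x, hx⟩
      have hxg : x.1 = g := congrArg Subtype.val hx
      exact hg (hxg ▸ x.2)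
    · exact Function.extend_apply' _ _ _ (by rintro ⟨x, rfl⟩; exact hgK x.2)

variable (M : Type v) [AddCommGroup M] [RngModule G.Alg M]

/-- The `ℤH`-module `ℤH · M`. -/
abbrev Res (H : G.OpenSubgroupoid) : Type v := H.incl.resGroup M

theorem resGroup_mono {H K : G.OpenSubgroupoid} (h : H.carrier ⊆ K.carrier) :
    H.incl.resGroup M ≤ K.incl.resGroup M := by
  refine (AddSubgroup.closure_le _).2 ?_
  rintro _ ⟨f, m, rfl⟩
  rw [← algMap_inclusion h]
  exact K.incl.smul_mem_resGroup M _ _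

/-- The map `H_n(H, ℤH · M) → H_n(K, ℤK · M)` for open subgroupoids `H ⊆ K`. -/
def resHomologyMap {H K : G.OpenSubgroupoid} (h : H.carrier ⊆ K.carrier) (n : ℕ) :
    H.toGroupoid.Homology n (H.Res M) →+ K.toGroupoid.Homology n (K.Res M) :=
  (inclusion h).homologyMap (AddSubgroup.inclusion (resGroup_mono M h)) (fun f m =>
    Subtype.ext (by
      change H.incl.algMap f • m.1 = K.incl.algMap ((inclusion h).algMap f) • m.1
      rw [algMap_inclusion])) n

/-- The map `H_n(H, ℤH · M) → H_n(G, M)` for an open subgroupoid `H`. -/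
def inclHomologyMap (H : G.OpenSubgroupoid) (n : ℕ) :
    H.toGroupoid.Homology n (H.Res M) →+ G.Homology n M :=
  H.incl.homologyMap (H.incl.resGroup M).subtype (fun _ _ => rfl) n

/-- The map `H_n(H) → H_n(K)` for open subgroupoids `H ⊆ K`. -/
def trivHomologyMap {H K : G.OpenSubgroupoid} (h : H.carrier ⊆ K.carrier) (n : ℕ) :
    H.toGroupoid.Homology n H.toGroupoid.ZObj →+ K.toGroupoid.Homology n K.toGroupoid.ZObj :=
  (inclusion h).homologyMap (inclusion h).objMap (inclusion h).objMap_smul n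

/-- The map `H_n(H) → H_n(G)` for an open subgroupoid `H`. -/
def inclTrivHomologyMap (H : G.OpenSubgroupoid) (n : ℕ) :
    H.toGroupoid.Homology n H.toGroupoid.ZObj →+ G.Homology n G.ZObj :=
  H.incl.homologyMap H.incl.objMap H.incl.objMap_smul n

end OpenSubgroupoid

end AmpleGroupoid

end

/-! Everything in sight is a directed union, and each construction in the definition of Tor involves
only finitely many elements and equations at a time.

Extension by zero embeds `ℤH_i` in `ℤG` and `ℤH_i⁰` in `ℤG⁰`. A compact open set is covered by the
directed open sets `H_i`, hence lies in one of them. Since `ℤG` is spanned by characteristic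
functions of compact bisections, and `ℤG⁰` by those of compact open sets of units, both are directed
unions of their counterparts for the `H_i` (`isDirectedUnion_alg`, `isDirectedUnion_zObj`). If `M`
is unitary it is then the directed union of the subgroups `ℤH_i · M` (`isDirectedUnion_res`).

The rest is algebra over a directed union of rings with local units. The standard resolution is
strictly functorial in ring and module together: the cover `⨁ eR → A` is indexed by all pairs `(e,
a)` with `e` idempotent and `ae = a`, so no lifts are chosen and no chain homotopies occur. An
element of the cover consists of finitely many ring and module elements subject to finitely many
equations. All of them come from one stage, and injectivity of the maps to the union makes the
equations hold already there. Hence covers, their kernels, and by iteration all terms of the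
standard resolution are again directed unions (`isDirectedUnion_cover`, `isDirectedUnion_syzygy`).

Tensoring need not preserve injectivity, so from there on the notion is that of a direct limit: the
tensor products over the rings of the system have as limit the tensor product over the union
(`isAddDirectLimit_tens`). Homology of complexes commutes with directed limits, which gives
`isAddDirectLimit_tor`. No flatness of `ℤG` over `ℤH_i` is needed, and the `H_i` need not contain
all units, because the argument never changes rings within a single resolution. -/

/-! ### Directed unions of sets -/

/-- The injective maps `g i : X i → Y`, compatible with the transition maps `f`, exhibit `Y` as a
directed union of the `X i`. -/
structure IsDirectedUnion {D : Type*} [Preorder D] {X : D → Type*} {Y : Type*}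
    (f : ∀ i j, i ≤ j → X i → X j) (g : ∀ i, X i → Y) : Prop where
  comp : ∀ i j h x, g j (f i j h x) = g i x
  injective : ∀ i, Function.Injective (g i)
  exists_rep : ∀ y, ∃ i x, g i x = y

namespace IsDirectedUnion

variable {D : Type*} [Preorder D] {X : D → Type*} {Y : Type*}
  {f : ∀ i j, i ≤ j → X i → X j} {g : ∀ i, X i → Y}

/-- Functoriality of the transition maps is not part of the structure: it can be tested after the
injective map into the union, where both sides become the image of `x`. -/
theorem comp_trans (h : IsDirectedUnion f g) {i j k : D} (hij : i ≤ j) (hjk : j ≤ k) (x : X i) :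
    f j k hjk (f i j hij x) = f i k (hij.trans hjk) x :=
  h.injective k (by rw [h.comp, h.comp, h.comp])

theorem map_self (h : IsDirectedUnion f g) {i : D} (hi : i ≤ i) (x : X i) : f i i hi x = x :=
  h.injective i (h.comp _ _ _ _)

theorem exists_rep_ge [IsDirectedOrder D] (h : IsDirectedUnion f g) (y : Y) (i₀ : D) :
    ∃ i, i₀ ≤ i ∧ ∃ x, g i x = y := by
  obtain ⟨i, x, rfl⟩ := h.exists_rep y
  obtain ⟨k, h1, h2⟩ := exists_ge_ge i₀ i
  exact ⟨k, h1, f i k h2 x, h.comp _ _ _ _⟩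

end IsDirectedUnion

/-! ### Direct limits of abelian groups, described by elements -/

/-- The maps `g i : X i → Y` exhibit the abelian group `Y` as the direct limit of the directed
system `X`. -/
structure IsAddDirectLimit {D : Type*} [Preorder D] {X : D → Type*} {Y : Type*}
    [∀ i, AddCommGroup (X i)] [AddCommGroup Y]
    (f : ∀ i j, i ≤ j → X i →+ X j) (g : ∀ i, X i →+ Y) : Prop where
  map_self : ∀ i h x, f i i h x = x
  comp_trans : ∀ i j k hij hjk x, f j k hjk (f i j hij x) = f i k (hij.trans hjk) x
  comp : ∀ i j h x, g j (f i j h x) = g i x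
  exists_rep : ∀ y, ∃ i x, g i x = y
  exists_eq_zero : ∀ i x, g i x = 0 → ∃ j h, f i j h x = 0

namespace IsAddDirectLimit

variable {D : Type*} [Preorder D] {X : D → Type*} {Y : Type*}
    [∀ i, AddCommGroup (X i)] [AddCommGroup Y]
    {f : ∀ i j, i ≤ j → X i →+ X j} {g : ∀ i, X i →+ Y}

theorem directedSystem (h : IsAddDirectLimit f g) :
    DirectedSystem X (fun i j hij => f i j hij) where
  map_self i x := h.map_self i le_rfl x
  map_map _ _ _ hij hjk x := h.comp_trans _ _ _ hij hjk x

/-- The map from the direct limit induced by the `g i` is onto by `exists_rep`. Since `D` is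
directed and nonempty, every element of the limit comes from one stage, so `exists_eq_zero` is
exactly triviality of the kernel. -/
theorem exists_equiv [IsDirectedOrder D] [Nonempty D] [DecidableEq D]
    (h : IsAddDirectLimit f g) :
    ∃ e : AddCommGroup.DirectLimit X f ≃+ Y,
      ∀ i x, e (AddCommGroup.DirectLimit.of _ _ i x) = g i x := by
  have := h.directedSystem
  let l := AddCommGroup.DirectLimit.lift X f Y g fun i j hij x => h.comp i j hij x
  have hl : ∀ i x, l (AddCommGroup.DirectLimit.of X f i x) = g i x :=
    fun i x => AddCommGroup.DirectLimit.lift_of (G := X) (f := f) Y g _ i x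
  refine ⟨AddEquiv.ofBijective l ⟨?_, fun y => ?_⟩, hl⟩
  · rw [injective_iff_map_eq_zero]
    intro z
    induction z using AddCommGroup.DirectLimit.induction_on with
    | ih i x =>
      intro hz
      obtain ⟨j, hij, hj⟩ := h.exists_eq_zero i x ((hl i x).symm.trans hz)
      rw [← AddCommGroup.DirectLimit.of_f (hij := hij), hj, map_zero]
  · obtain ⟨i, x, rfl⟩ := h.exists_rep y
    exact ⟨_, hl i x⟩

theorem exists_rep_ge [IsDirectedOrder D] (h : IsAddDirectLimit f g) (y : Y) (i₀ : D) :
    ∃ i, i₀ ≤ i ∧ ∃ x, g i x = y := by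
  obtain ⟨i, x, rfl⟩ := h.exists_rep y
  obtain ⟨k, h1, h2⟩ := exists_ge_ge i₀ i
  exact ⟨k, h1, f i k h2 x, h.comp _ _ _ _⟩

end IsAddDirectLimit

/-! ### Additive maps on tensor products; functoriality and injectivity for covers and kernels -/

namespace UnitaryRightModule

/-- Reduces every identity between maps out of `A ⊗_R M` used below to elementary tensors, where it
usually holds by unfolding. -/
theorem tens_hom_ext {R : Type u} [NonUnitalRing R] {A : UnitaryRightModule R} {M : Type v}
    [AddCommGroup M] [RngModule R M] {Z : Type*} [AddCommGroup Z] (p q : Tens A M →+ Z)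
    (h : ∀ a m, p (QuotientAddGroup.mk (a ⊗ₜ[ℤ] m)) = q (QuotientAddGroup.mk (a ⊗ₜ[ℤ] m)))
    (t : Tens A M) : p t = q t := by
  obtain ⟨t, rfl⟩ := QuotientAddGroup.mk_surjective t
  induction t using TensorProduct.induction_on with
  | zero => exact p.map_zero.trans q.map_zero.symm
  | tmul a m => exact h a m
  | add t t' h h' =>
    exact (p.map_add _ _).trans ((congrArg₂ (· + ·) h h').trans (q.map_add _ _).symm)

section Comp

variable {R S T : Type u} [NonUnitalRing R] [NonUnitalRing S] [NonUnitalRing T]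
  {φ : R →ₙ+* S} {ψ : S →ₙ+* T} {χ : R →ₙ+* T}
  {A : UnitaryRightModule R} {B : UnitaryRightModule S} {C : UnitaryRightModule T}

theorem coverIndex_map_injective (α : SemiHom φ A B) (hφ : Function.Injective φ)
    (hα : Function.Injective α.add) : Function.Injective (CoverIndex.map α) := by
  rintro ⟨⟨e, a⟩, h⟩ ⟨⟨e', a'⟩, h'⟩ hh
  have := Prod.ext_iff.1 (Subtype.ext_iff.1 hh)
  exact Subtype.ext (Prod.ext (hφ this.1) (hα this.2))

variable [HasLocalUnits R] [HasLocalUnits S] [HasLocalUnits T]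

/-- Separates the change of coefficients from the change of index, so that injectivity of
`coverSemi` splits into injectivity of `φ` and injectivity of the map on pairs `(e, a)`. -/
theorem coverSemi_val (α : SemiHom φ A B) (F : cover A) :
    ((coverSemi α).add F : coverGroup B).1 =
      ((F : coverGroup A).1.mapRange φ (map_zero φ)).mapDomain (CoverIndex.map α) := by
  rw [Finsupp.mapDomain, Finsupp.sum_mapRange_index (fun j => by simp)]
  rfl

theorem coverSemi_injective (α : SemiHom φ A B) (hφ : Function.Injective φ)
    (hα : Function.Injective α.add) : Function.Injective (coverSemi α).add := by
  intro F F' h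
  have h' := congrArg (Subtype.val (p := fun F => F ∈ coverGroup B)) h
  rw [coverSemi_val, coverSemi_val] at h'
  exact Subtype.ext (Finsupp.mapRange_injective φ (map_zero φ) hφ
    (Finsupp.mapDomain_injective (coverIndex_map_injective α hφ hα) h'))

/-- Each summand goes to the summand of the image pair, so composition is strict. The composite is a
separate `γ` over a separate `χ`, with only pointwise hypotheses, so that the maps of a directed
union can be inserted directly without identifying ring homomorphisms. -/
theorem coverSemi_comp {α : SemiHom φ A B} {β : SemiHom ψ B C} {γ : SemiHom χ A C}
    (hφ : ∀ x, ψ (φ x) = χ x) (h : ∀ a, β.add (α.add a) = γ.add a) (F : cover A) :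
    (coverSemi β).add ((coverSemi α).add F) = (coverSemi γ).add F := by
  refine Subtype.ext ?_
  change Finsupp.liftAddHom _ (Finsupp.sum _ _) = Finsupp.sum _ _
  rw [map_finsuppSum]
  refine Finsupp.sum_congr fun j _ => ?_
  refine (Finsupp.liftAddHom_apply_single _ _ _).trans ?_
  change Finsupp.single (CoverIndex.map β (CoverIndex.map α j)) (ψ (φ _)) =
    Finsupp.single (CoverIndex.map γ j) (χ _)
  rw [hφ]
  congr 1
  exact Subtype.ext (Prod.ext (hφ _) (h _))

theorem syzygySemi_comp {α : SemiHom φ A B} {β : SemiHom ψ B C} {γ : SemiHom χ A C}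
    (hφ : ∀ x, ψ (φ x) = χ x) (h : ∀ a, β.add (α.add a) = γ.add a) (F : syzygy A) :
    (syzygySemi β).add ((syzygySemi α).add F) = (syzygySemi γ).add F :=
  Subtype.ext (coverSemi_comp hφ h (F : syzygyGroup A).1)

theorem syzygySemi_injective (α : SemiHom φ A B) (hφ : Function.Injective φ)
    (hα : Function.Injective α.add) : Function.Injective (syzygySemi α).add :=
  fun _ _ h => Subtype.ext (coverSemi_injective α hφ hα (congrArg Subtype.val h))

end Comp

/-! ### Tensor products over a directed union of rings -/

section System

variable {D : Type w} [Preorder D] [IsDirectedOrder D]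
  {R : D → Type u} [∀ i, NonUnitalRing (R i)] {R' : Type u} [NonUnitalRing R']
  {φ : ∀ i j, i ≤ j → R i →ₙ+* R j} {φ' : ∀ i, R i →ₙ+* R'}
  {A : ∀ i, UnitaryRightModule (R i)} {A' : UnitaryRightModule R'}

section Tensor

variable {M : D → Type v} [∀ i, AddCommGroup (M i)] [∀ i, RngModule (R i) (M i)]
  {M' : Type v} [AddCommGroup M'] [RngModule R' M']
  {α : ∀ i j h, SemiHom (φ i j h) (A i) (A j)} {α' : ∀ i, SemiHom (φ' i) (A i) A'}
  {β : ∀ i j, i ≤ j → M i →+ M j} {β' : ∀ i, M i →+ M'}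

/-- Tensor products commute with directed unions. -/
theorem isAddDirectLimit_tens [Nonempty D]
    (hφ : IsDirectedUnion (fun i j h => φ i j h) (fun i => φ' i))
    (hα : IsDirectedUnion (fun i j h => (α i j h).add) (fun i => (α' i).add))
    (hβ : IsDirectedUnion (fun i j h => β i j h) (fun i => β' i))
    (bβ : ∀ i j h (x : R i) (m : M i), β i j h (x • m) = φ i j h x • β i j h m)
    (bβ' : ∀ i (x : R i) (m : M i), β' i (x • m) = φ' i x • β' i m) :
    IsAddDirectLimit
      (fun i j h => Tens.map (φ i j h) (α i j h).add (α i j h).map_smul (β i j h) (bβ i j h))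
      (fun i => Tens.map (φ' i) (α' i).add (α' i).map_smul (β' i) (bβ' i)) := by
  classical
  set f : ∀ i j, i ≤ j → Tens (A i) (M i) →+ Tens (A j) (M j) := fun i j h =>
    Tens.map (φ i j h) (α i j h).add (α i j h).map_smul (β i j h) (bβ i j h)
  set g : ∀ i, Tens (A i) (M i) →+ Tens A' M' := fun i =>
    Tens.map (φ' i) (α' i).add (α' i).map_smul (β' i) (bβ' i)
  let tm : ∀ i, A i → M i → Tens (A i) (M i) := fun i a m => QuotientAddGroup.mk (a ⊗ₜ[ℤ] m)
  have f_tm : ∀ i j h a m, f i j h (tm i a m) = tm j ((α i j h).add a) (β i j h m) :=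
    fun i j h a m => rfl
  have g_tm : ∀ i a m, g i (tm i a m) =
      (QuotientAddGroup.mk ((α' i).add a ⊗ₜ[ℤ] β' i m) : Tens A' M') := fun i a m => rfl
  have trans_ : ∀ i j k hij hjk x, f j k hjk (f i j hij x) = f i k (hij.trans hjk) x := by
    intro i j k hij hjk
    refine tens_hom_ext ((f j k hjk).comp (f i j hij)) _ fun a m => ?_
    exact congrArg₂ (tm k) (hα.comp_trans hij hjk a) (hβ.comp_trans hij hjk m)
  have self_ : ∀ i h x, f i i h x = x := by
    intro i h
    refine tens_hom_ext (f i i h) (AddMonoidHom.id _) fun a m => ?_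
    exact congrArg₂ (tm i) (hα.map_self h a) (hβ.map_self h m)
  have : DirectedSystem (fun i => Tens (A i) (M i)) (fun i j hij => f i j hij) :=
    ⟨fun i x => self_ i le_rfl x, fun k j i hij hjk x => trans_ _ _ _ hij hjk x⟩
  let L := AddCommGroup.DirectLimit (fun i => Tens (A i) (M i)) f
  let o : ∀ i, Tens (A i) (M i) →+ L := AddCommGroup.DirectLimit.of _ _
  have o_f : ∀ i j h x, o j (f i j h x) = o i x := fun i j h x =>
    AddCommGroup.DirectLimit.of_f (f := f) h x
  -- The class of an elementary tensor in the limit depends only on the images of its factors in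
  -- `A'` and `M'`: at a common later stage the factors themselves agree, since the maps into the
  -- unions are injective.
  have o_eq : ∀ i j a m a' m', (α' i).add a = (α' j).add a' → β' i m = β' j m' →
      o i (tm i a m) = o j (tm j a' m') := by
    intro i j a m a' m' ha hm
    obtain ⟨k, hik, hjk⟩ := exists_ge_ge i j
    rw [← o_f i k hik, ← o_f j k hjk, f_tm, f_tm]
    congr 2
    · exact hα.injective k (by rw [hα.comp, hα.comp, ha])
    · exact hβ.injective k (by rw [hβ.comp, hβ.comp, hm])
  have rep : ∀ (a : A') (m : M'), ∃ i b n, (α' i).add b = a ∧ β' i n = m := by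
    intro a m
    obtain ⟨i, b, hb⟩ := hα.exists_rep a
    obtain ⟨j, hij, n, hn⟩ := hβ.exists_rep_ge m i
    exact ⟨j, (α i j hij).add b, n, (hα.comp _ _ _ _).trans hb, hn⟩
  choose I b n hb hn using rep
  -- Representatives at a common stage are chosen arbitrarily; `o_eq` makes the choice irrelevant.
  -- Additivity and balance are therefore checked by moving all the elements involved to one stage.
  let B : A' → M' → L := fun a m => o (I a m) (tm _ (b a m) (n a m))
  have B_eq : ∀ i a m, B ((α' i).add a) (β' i m) = o i (tm i a m) := fun i a m =>
    o_eq _ _ _ _ _ _ (hb _ _) (hn _ _)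
  have B_add_right : ∀ a m m', B a (m + m') = B a m + B a m' := by
    intro a m m'
    obtain ⟨i, a, rfl⟩ := hα.exists_rep a
    obtain ⟨j, hij, m, rfl⟩ := hβ.exists_rep_ge m i
    obtain ⟨k, hjk, m', rfl⟩ := hβ.exists_rep_ge m' j
    rw [← hα.comp i k (hij.trans hjk) a, ← hβ.comp j k hjk m, ← map_add, B_eq, B_eq, B_eq,
      ← map_add]
    exact congrArg (fun z => o k (QuotientAddGroup.mk z)) (TensorProduct.tmul_add _ _ _)
  have B_add_left : ∀ a a' m, B (a + a') m = B a m + B a' m := by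
    intro a a' m
    obtain ⟨i, m, rfl⟩ := hβ.exists_rep m
    obtain ⟨j, hij, a, rfl⟩ := hα.exists_rep_ge a i
    obtain ⟨k, hjk, a', rfl⟩ := hα.exists_rep_ge a' j
    rw [← hβ.comp i k (hij.trans hjk) m, ← hα.comp j k hjk a, ← map_add, B_eq, B_eq, B_eq,
      ← map_add]
    exact congrArg (fun z => o k (QuotientAddGroup.mk z)) (TensorProduct.add_tmul _ _ _)
  -- The scalar `x` must be represented as well, and this is where the ring `R'` has to be the union
  -- of the `R i`. At a common stage the identity is one of the relations defining the tensor
  -- product over `R k`.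
  have B_bal : ∀ (a : A') (x : R') (m : M'), B (MulOpposite.op x • a) m = B a (x • m) := by
    intro a x m
    obtain ⟨i, m, rfl⟩ := hβ.exists_rep m
    obtain ⟨j, hij, a, rfl⟩ := hα.exists_rep_ge a i
    obtain ⟨k, hjk, x, rfl⟩ := hφ.exists_rep_ge x j
    rw [← hβ.comp i k (hij.trans hjk) m, ← hα.comp j k hjk a, ← bβ']
    refine (congrArg (B · _) ((α' k).map_smul x _).symm).trans ?_
    rw [B_eq]
    refine (B_eq k (MulOpposite.op x • _) _).trans (congrArg (o k) ?_)
    refine QuotientAddGroup.eq_iff_sub_mem.2 (AddSubgroup.subset_closure ⟨_, _, _, rfl⟩)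
  let Bh : A' →+ M' →+ L := AddMonoidHom.mk' (fun a => AddMonoidHom.mk' (B a) (B_add_right a))
    fun a a' => AddMonoidHom.ext fun m => B_add_left a a' m
  -- The map back to the limit. Only `Φ ∘ g i = o i` is needed: it shows that whatever `g i` kills
  -- already vanishes in the limit.
  let Φ : Tens A' M' →+ L := QuotientAddGroup.lift _
    (TensorProduct.liftAddHom (R := ℤ) Bh fun r a m => by
      rw [map_zsmul, map_zsmul]; rfl) (by
    refine (AddSubgroup.closure_le _).2 ?_
    rintro _ ⟨a, x, m, rfl⟩
    refine (AddMonoidHom.mem_ker).2 ?_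
    rw [map_sub, sub_eq_zero]
    exact B_bal a x m)
  have Φg : ∀ i t, Φ (g i t) = o i t := fun i =>
    tens_hom_ext (Φ.comp (g i)) (o i) fun a m => B_eq i a m
  have comp_ : ∀ i j h x, g j (f i j h x) = g i x := by
    intro i j h
    refine tens_hom_ext ((g j).comp (f i j h)) _ fun a m => ?_
    exact congrArg₂ (fun a m => (QuotientAddGroup.mk (a ⊗ₜ[ℤ] m) : Tens A' M'))
      (hα.comp i j h a) (hβ.comp i j h m)
  refine ⟨self_, trans_, comp_, fun t => ?_, fun i t ht => ?_⟩
  · obtain ⟨t, rfl⟩ := QuotientAddGroup.mk_surjective t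
    -- A sum of tensors represented at different stages is represented at a common later one.
    induction t using TensorProduct.induction_on with
    | zero => exact ⟨Classical.arbitrary D, 0, map_zero _⟩
    | tmul a m => exact ⟨I a m, tm _ (b a m) (n a m), by
        rw [g_tm, hb, hn]⟩
    | add t t' h h' =>
      obtain ⟨i, x, hx⟩ := h
      obtain ⟨j, x', hx'⟩ := h'
      obtain ⟨k, hik, hjk⟩ := exists_ge_ge i j
      exact ⟨k, f i k hik x + f j k hjk x', by rw [map_add, comp_, comp_, hx, hx']; rfl⟩
  -- Vanishing in the limit of a directed system means vanishing at some later stage.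
  · have h0 : o i t = 0 := by rw [← Φg, ht, map_zero]
    obtain ⟨j, hij, hj⟩ := AddCommGroup.DirectLimit.of.zero_exact (f := f) i t h0
    exact ⟨j, hij, hj⟩

end Tensor

/-! ### Covers and iterated kernels of directed unions -/

variable [∀ i, HasLocalUnits (R i)] [HasLocalUnits R']
  {α : ∀ i j h, SemiHom (φ i j h) (A i) (A j)} {α' : ∀ i, SemiHom (φ' i) (A i) A'}

/-- An element is a finite sum of terms `x` in the summand of `(e, a)`, subject to `ee = e`, `ae =
a` and `ex = x`. The elements `e`, `a`, `x` come from a single stage, and the equations hold there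
because the maps into `R'` and `A'` are injective. -/
theorem isDirectedUnion_cover [Nonempty D]
    (hφ : IsDirectedUnion (fun i j h => φ i j h) (fun i => φ' i))
    (hα : IsDirectedUnion (fun i j h => (α i j h).add) (fun i => (α' i).add)) :
    IsDirectedUnion (fun i j h => (coverSemi (α i j h)).add) (fun i => (coverSemi (α' i)).add) := by
  have hcomp : ∀ i j h x, (coverSemi (α' j)).add ((coverSemi (α i j h)).add x) =
      (coverSemi (α' i)).add x :=
    fun i j h => coverSemi_comp (hφ.comp i j h) (hα.comp i j h)
  refine ⟨hcomp, fun i => coverSemi_injective _ (hφ.injective i) (hα.injective i), fun F => ?_⟩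
  obtain ⟨F, hF⟩ := F
  induction F using Finsupp.induction with
  | zero => exact ⟨Classical.arbitrary D, 0, map_zero _⟩
  | single_add j x F hj hx ih =>
    have hFj : F j = 0 := by simpa using hj
    have hxj : j.1.1 * x = x := by
      have := hF j
      simpa [hFj] using this
    have h1 := single_mem_coverGroup A' j x hxj
    have h2 : F ∈ coverGroup A' := by
      have := (coverGroup A').sub_mem hF h1
      simpa using this
    obtain ⟨i₀, F₀, hF₀⟩ := ih h2
    obtain ⟨⟨e, a⟩, he, ha⟩ := j
    obtain ⟨i₁, h₁, e, rfl⟩ := hφ.exists_rep_ge e i₀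
    obtain ⟨i₂, h₂, a, rfl⟩ := hα.exists_rep_ge a i₁
    -- The stages are chosen successively, each above the previous one, so that `i₃` accommodates
    -- `e`, `a`, `x` and the representative `F₀` of the remaining sum.
    obtain ⟨i₃, h₃, x, rfl⟩ := hφ.exists_rep_ge x i₂
    have E := hφ.comp i₁ i₃ (h₂.trans h₃) e
    have EA := hα.comp i₂ i₃ h₃ a
    set e' := φ i₁ i₃ (h₂.trans h₃) e
    set a' := (α i₂ i₃ h₃).add a
    dsimp only at he ha hxj E EA
    -- Injectivity at stage `i₃` pulls the defining equations of the index `(e, a)` back from `R'`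
    -- and `A'`, so that `(e', a')` is an index of the cover at that stage.
    have he' : e' * e' = e' := hφ.injective i₃ (by rw [map_mul, E, he])
    have ha' : MulOpposite.op e' • a' = a' := hα.injective i₃ (by
      refine ((α' i₃).map_smul e' a').trans ?_
      refine (congrArg₂ (fun (z : R') (y : A') => MulOpposite.op z • y) E EA).trans ?_
      exact ha.trans EA.symm)
    have hx' : e' * x = x := hφ.injective i₃ (by rw [map_mul, E, hxj])
    let J : CoverIndex (A i₃) := ⟨(e', a'), he', ha'⟩
    refine ⟨i₃, (show cover (A i₃) from ⟨Finsupp.single J x, single_mem_coverGroup _ J x hx'⟩) +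
      (coverSemi (α i₀ i₃ (h₁.trans (h₂.trans h₃)))).add F₀, ?_⟩
    refine (map_add (coverSemi (α' i₃)).add _ _).trans ?_
    rw [hcomp, hF₀]
    refine Subtype.ext ?_
    change ((coverSemi (α' i₃)).add _ : coverGroup A').1 + F = _
    rw [coverSemi_val]
    change ((Finsupp.single J x).mapRange (φ' i₃) _).mapDomain _ + F = _
    rw [Finsupp.mapRange_single, Finsupp.mapDomain_single]
    congr 2
    exact Subtype.ext (Prod.ext E EA)

/-- A representative in the cover at stage `i` of an element of the kernel lies in the kernel
itself: its image in `A i` becomes zero in `A'`, and `A i → A'` is injective. -/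
theorem isDirectedUnion_syzygy [Nonempty D]
    (hφ : IsDirectedUnion (fun i j h => φ i j h) (fun i => φ' i))
    (hα : IsDirectedUnion (fun i j h => (α i j h).add) (fun i => (α' i).add)) :
    IsDirectedUnion (fun i j h => (syzygySemi (α i j h)).add)
      (fun i => (syzygySemi (α' i)).add) where
  comp i j h := syzygySemi_comp (hφ.comp i j h) (hα.comp i j h)
  injective i := syzygySemi_injective _ (hφ.injective i) (hα.injective i)
  exists_rep F := by
    obtain ⟨F, hF⟩ := F
    obtain ⟨i, F₀, rfl⟩ := (isDirectedUnion_cover hφ hα).exists_rep F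
    refine ⟨i, (⟨F₀, hα.injective i ?_⟩ : syzygyGroup (A i)), rfl⟩
    exact (coverMap_coverSemi (α' i) F₀).symm.trans (hF.trans (map_zero _).symm)

theorem isDirectedUnion_iterSyzygy [Nonempty D]
    (hφ : IsDirectedUnion (fun i j h => φ i j h) (fun i => φ' i))
    (hα : IsDirectedUnion (fun i j h => (α i j h).add) (fun i => (α' i).add)) (n : ℕ) :
    IsDirectedUnion (fun i j h => (iterSyzygySemi (α i j h) n).add)
      (fun i => (iterSyzygySemi (α' i) n).add) := by
  induction n with
  | zero => exact hα
  | succ n ih => exact isDirectedUnion_syzygy hφ ih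

/-! ### The standard complex and Tor of a directed union -/

variable {M : D → Type v} [∀ i, AddCommGroup (M i)] [∀ i, RngModule (R i) (M i)]
  {M' : Type v} [AddCommGroup M'] [RngModule R' M']
  {β : ∀ i j, i ≤ j → M i →+ M j} {β' : ∀ i, M i →+ M'}

/-- In degree `n` the resolution is the cover of the `n`-th iterated kernel, a directed union by the
preceding results; the tensor product turns it into a direct limit. -/
theorem isAddDirectLimit_chain [Nonempty D]
    (hφ : IsDirectedUnion (fun i j h => φ i j h) (fun i => φ' i))
    (hα : IsDirectedUnion (fun i j h => (α i j h).add) (fun i => (α' i).add))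
    (hβ : IsDirectedUnion (fun i j h => β i j h) (fun i => β' i))
    (bβ : ∀ i j h (x : R i) (m : M i), β i j h (x • m) = φ i j h x • β i j h m)
    (bβ' : ∀ i (x : R i) (m : M i), β' i (x • m) = φ' i x • β' i m) (n : ℕ) :
    IsAddDirectLimit (fun i j h => chainMap (α i j h) (β i j h) (bβ i j h) n)
      (fun i => chainMap (α' i) (β' i) (bβ' i) n) :=
  isAddDirectLimit_tens hφ (isDirectedUnion_cover hφ (isDirectedUnion_iterSyzygy hφ hα n)) hβ bβ bβ'

/-- Tor commutes with directed unions. -/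
theorem isAddDirectLimit_tor [Nonempty D]
    (hφ : IsDirectedUnion (fun i j h => φ i j h) (fun i => φ' i))
    (hα : IsDirectedUnion (fun i j h => (α i j h).add) (fun i => (α' i).add))
    (hβ : IsDirectedUnion (fun i j h => β i j h) (fun i => β' i))
    (bβ : ∀ i j h (x : R i) (m : M i), β i j h (x • m) = φ i j h x • β i j h m)
    (bβ' : ∀ i (x : R i) (m : M i), β' i (x • m) = φ' i x • β' i m) (n : ℕ) :
    IsAddDirectLimit (fun i j h => Tor.map (α i j h) (β i j h) (bβ i j h) n)
      (fun i => Tor.map (α' i) (β' i) (bβ' i) n) := by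
  have hc := isAddDirectLimit_chain hφ hα hβ bβ bβ'
  refine ⟨fun i h x => ?_, fun i j k hij hjk x => ?_, fun i j h x => ?_, fun y => ?_,
    fun i x hx => ?_⟩
  · obtain ⟨x, rfl⟩ := QuotientAddGroup.mk_surjective x
    exact congrArg QuotientAddGroup.mk (Subtype.ext ((hc n).map_self i h x.1))
  · obtain ⟨x, rfl⟩ := QuotientAddGroup.mk_surjective x
    exact congrArg QuotientAddGroup.mk (Subtype.ext ((hc n).comp_trans i j k hij hjk x.1))
  · obtain ⟨x, rfl⟩ := QuotientAddGroup.mk_surjective x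
    exact congrArg QuotientAddGroup.mk (Subtype.ext ((hc n).comp i j h x.1))
  · obtain ⟨⟨y, hy⟩, rfl⟩ := QuotientAddGroup.mk_surjective y
    obtain ⟨i, x, hx⟩ := (hc n).exists_rep y
    -- The representative `x` of the cycle `y` need not be a cycle, but its boundary becomes zero in
    -- the limit complex, hence at a later stage `j`. In degree 0 every chain is a cycle and nothing
    -- has to be moved.
    have key : ∃ j h, chainMap (α i j h) (β i j h) (bβ i j h) n x ∈
        (standardResolution (A j)).cycles (M j) n := by
      cases n with
      | zero => exact ⟨i, le_rfl, trivial⟩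
      | succ n =>
        have h0 : chainMap (α' i) (β' i) (bβ' i) n
            ((standardResolution (A i)).dTens (M i) n x) = 0 := by
          rw [chainMap_d]
          exact (congrArg _ hx).trans hy
        obtain ⟨j, h, hj⟩ := (hc n).exists_eq_zero _ _ h0
        refine ⟨j, h, ?_⟩
        change (standardResolution (A j)).dTens (M j) n _ = 0
        rw [← chainMap_d]
        exact hj
    obtain ⟨j, h, hj⟩ := key
    exact ⟨j, QuotientAddGroup.mk ⟨_, hj⟩,
      congrArg QuotientAddGroup.mk (Subtype.ext (((hc n).comp i j h x).trans hx))⟩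
  · obtain ⟨x, rfl⟩ := QuotientAddGroup.mk_surjective x
    obtain ⟨w, hw⟩ := (QuotientAddGroup.eq_zero_iff _).1 hx
    -- The chain bounding the image of `x` is represented at a stage `j` above `i`. There `x` and
    -- the boundary of `w` need not agree; their difference vanishes in the limit, so they agree
    -- from some stage `k` on.
    obtain ⟨j, hij, w, rfl⟩ := (hc (n + 1)).exists_rep_ge w i
    have h0 : chainMap (α' j) (β' j) (bβ' j) n (chainMap (α i j hij) (β i j hij) (bβ i j hij) n x.1 -
        (standardResolution (A j)).dTens (M j) n w) = 0 := by
      rw [map_sub, sub_eq_zero, chainMap_d]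
      exact ((hc n).comp i j hij x.1).trans hw.symm
    obtain ⟨k, hjk, hk⟩ := (hc n).exists_eq_zero _ _ h0
    refine ⟨k, hij.trans hjk, (QuotientAddGroup.eq_zero_iff _).2
      ⟨chainMap (α j k hjk) (β j k hjk) (bβ j k hjk) (n + 1) w, ?_⟩⟩
    rw [← chainMap_d]
    rw [map_sub, sub_eq_zero] at hk
    exact hk.symm.trans ((hc n).comp_trans i j k hij hjk x.1)

end System

end UnitaryRightModule

/-! ### Extension by zero, and compact sets in directed open covers -/

namespace AmpleGroupoid

theorem zfunMap_apply {X Y : Type u} [TopologicalSpace X] [TopologicalSpace Y] {ι : X → Y}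
    (hι : Topology.IsOpenEmbedding ι) (f : ZFun X) (x : X) : (zfunMap hι f).1 (ι x) = f.1 x :=
  hι.injective.extend_apply _ _ _

theorem zfunMap_apply_of_forall {X Y : Type u} [TopologicalSpace X] [TopologicalSpace Y]
    {ι : X → Y} (hι : Topology.IsOpenEmbedding ι) (f : ZFun X) {y : Y} (hy : ∀ x, ι x ≠ y) :
    (zfunMap hι f).1 y = 0 :=
  Function.extend_apply' _ _ _ fun ⟨x, hx⟩ => hy x hx

theorem zfunMap_injective {X Y : Type u} [TopologicalSpace X] [TopologicalSpace Y] {ι : X → Y}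
    (hι : Topology.IsOpenEmbedding ι) : Function.Injective (zfunMap hι) := fun f f' h =>
  Subtype.ext (funext fun x => by rw [← zfunMap_apply hι, ← zfunMap_apply hι, h])

theorem zfunMap_zfunMap {X Y Z : Type u} [TopologicalSpace X] [TopologicalSpace Y]
    [TopologicalSpace Z] {ι : X → Y} {κ : Y → Z} {l : X → Z} (hι : Topology.IsOpenEmbedding ι)
    (hκ : Topology.IsOpenEmbedding κ) (hl : Topology.IsOpenEmbedding l)
    (h : ∀ x, κ (ι x) = l x) (f : ZFun X) : zfunMap hκ (zfunMap hι f) = zfunMap hl f := by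
  refine Subtype.ext (funext fun z => ?_)
  by_cases hz : ∃ y, κ y = z
  · obtain ⟨y, rfl⟩ := hz
    rw [zfunMap_apply]
    by_cases hy : ∃ x, ι x = y
    · obtain ⟨x, rfl⟩ := hy
      rw [zfunMap_apply, h, zfunMap_apply]
    · rw [zfunMap_apply_of_forall hι f fun x hx => hy ⟨x, hx⟩,
        zfunMap_apply_of_forall hl f fun x hx => hy ⟨x, hκ.injective ((h x).trans hx)⟩]
  · rw [zfunMap_apply_of_forall hκ _ fun y hy => hz ⟨y, hy⟩,
      zfunMap_apply_of_forall hl f fun x hx => hz ⟨ι x, (h x).trans hx⟩]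

/-- A finite subcover has an upper bound in the directed index set. This is the only use of
compactness in passing from `G` to some `H_i`. -/
theorem exists_subset_of_isCompact {X D : Type*} [TopologicalSpace X] [Preorder D]
    [IsDirectedOrder D] [Nonempty D] {U : D → Set X} (ho : ∀ i, IsOpen (U i))
    (hm : ∀ i j, i ≤ j → U i ⊆ U j) (hU : ⋃ i, U i = Set.univ) {K : Set X} (hK : IsCompact K) :
    ∃ i, K ⊆ U i :=
  hK.elim_directed_cover U ho (hU ▸ Set.subset_univ K) fun i j =>
    let ⟨k, hik, hjk⟩ := exists_ge_ge i j
    ⟨k, hm i k hik, hm j k hjk⟩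

/-! ### The groupoid ring, the trivial module and the coefficients as directed unions -/

namespace OpenSubgroupoid

variable {G : AmpleGroupoid.{u}} {D : Type w} [Preorder D] [IsDirectedOrder D] [Nonempty D]
  {H : D → G.OpenSubgroupoid}

/-- It suffices to represent the characteristic function of a compact bisection. Such a set lies in
a single `H_i`, is a compact bisection there, and its characteristic function on `H_i` extends by
zero to the original one. Sums are handled at a common stage. -/
theorem isDirectedUnion_alg (hmono : ∀ i j, i ≤ j → (H i).carrier ⊆ (H j).carrier)
    (hunion : ⋃ i, (H i).carrier = Set.univ) :
    IsDirectedUnion (fun i j h => (inclusion (hmono i j h)).algMap)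
      (fun i => (H i).incl.algMap) := by
  refine ⟨fun i j h => algMap_inclusion (hmono i j h),
    fun i => zfunMap_injective (H i).incl.isOpenEmbedding_arr, fun f => ?_⟩
  suffices h : ∃ i k, ((H i).incl.algMap k).1 = f.1 by
    obtain ⟨i, k, h⟩ := h
    exact ⟨i, k, Subtype.ext h⟩
  refine zfun_induction (p := fun f => ∃ i k, ((H i).incl.algMap k).1 = f) f.1 f.2
    (fun B hB => ?_) ⟨Classical.arbitrary D, 0, by rw [map_zero]; rfl⟩ ?_ ?_
  · obtain ⟨i, hi⟩ := exists_subset_of_isCompact (fun i => (H i).isOpen) hmono hunion hB.isCompact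
    have hK : (H i).toGroupoid.IsCBis (Subtype.val ⁻¹' B : Set (H i).carrier) :=
      { isOpen := hB.isOpen.preimage continuous_subtype_val
        isCompact := (Topology.IsInducing.subtypeVal.isCompact_preimage_iff
          (by simpa using hi)).2 hB.isCompact
        injOn_s := fun a ha b hb e => Subtype.ext (hB.injOn_s ha hb (congrArg Subtype.val e))
        injOn_r := fun a ha b hb e => Subtype.ext (hB.injOn_r ha hb (congrArg Subtype.val e)) }
    refine ⟨i, ⟨_, hK.mem_zfun⟩, (extendZero_indicator _ (H i).incl.isOpenEmbedding_arr.injective _).trans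
      (congrArg (Set.indicator · 1)
        ((Subtype.image_preimage_coe _ _).trans (Set.inter_eq_right.2 hi)))⟩
  · rintro _ - _ - ⟨i, k, rfl⟩ ⟨j, l, rfl⟩
    obtain ⟨m, him, hjm⟩ := exists_ge_ge i j
    refine ⟨m, (inclusion (hmono i m him)).algMap k + (inclusion (hmono j m hjm)).algMap l, ?_⟩
    rw [map_add, algMap_inclusion, algMap_inclusion]
    rfl
  · rintro _ - ⟨i, k, rfl⟩
    exact ⟨i, -k, by rw [map_neg]; rfl⟩

theorem objMap_inclusion {H K : G.OpenSubgroupoid} (h : H.carrier ⊆ K.carrier)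
    (f : H.toGroupoid.ZObj) : K.incl.objMap ((inclusion h).objMap f) = H.incl.objMap f :=
  zfunMap_zfunMap _ _ _ (fun _ => rfl) f

/-- The argument for arrows applies to compact open sets of units. Both module structures on `ℤG⁰`
have the same underlying group, so this serves for the resolved right module and for the left
coefficients. -/
theorem isDirectedUnion_zObj (hmono : ∀ i j, i ≤ j → (H i).carrier ⊆ (H j).carrier)
    (hunion : ⋃ i, (H i).carrier = Set.univ) :
    IsDirectedUnion (fun i j h => (inclusion (hmono i j h)).objMap)
      (fun i => (H i).incl.objMap) := by
  refine ⟨fun i j h => objMap_inclusion (hmono i j h),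
    fun i => zfunMap_injective (H i).incl.isOpenEmbedding_obj, fun f => ?_⟩
  suffices h : ∃ i k, ((H i).incl.objMap k).1 = f.1 by
    obtain ⟨i, k, h⟩ := h
    exact ⟨i, k, Subtype.ext h⟩
  refine zfun_obj_induction (p := fun f => ∃ i k, ((H i).incl.objMap k).1 = f) f.1 f.2
    (fun K ho hc => ?_) ⟨Classical.arbitrary D, 0, by rw [map_zero]; rfl⟩ ?_ ?_
  -- The unit spaces of the `H_i` are the preimages of the `H_i` under `G.one`; they are open and
  -- cover `G⁰` because the `H_i` cover `G`.
  · obtain ⟨i, hi⟩ := exists_subset_of_isCompact (U := fun i => G.one ⁻¹' (H i).carrier)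
      (fun i => (H i).isOpen.preimage G.continuous_one)
      (fun i j h => Set.preimage_mono (hmono i j h))
      (by rw [← Set.preimage_iUnion, hunion, Set.preimage_univ]) hc
    have hK := mem_zfun_obj (G := (H i).toGroupoid)
      (K := (Subtype.val ⁻¹' K : Set {x : G.Obj // G.one x ∈ (H i).carrier}))
      (ho.preimage continuous_subtype_val)
      ((Topology.IsInducing.subtypeVal.isCompact_preimage_iff
          (by rw [Subtype.range_coe_subtype]; exact hi)).2 hc)
    refine ⟨i, ⟨_, hK⟩, (extendZero_indicator _ (H i).incl.isOpenEmbedding_obj.injective _).trans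
      (congrArg (Set.indicator · 1)
        (Set.image_preimage_eq_of_subset fun x hx => ⟨⟨x, hi hx⟩, rfl⟩))⟩
  · rintro _ - _ - ⟨i, k, rfl⟩ ⟨j, l, rfl⟩
    obtain ⟨m, him, hjm⟩ := exists_ge_ge i j
    refine ⟨m, (inclusion (hmono i m him)).objMap k + (inclusion (hmono j m hjm)).objMap l, ?_⟩
    rw [map_add, objMap_inclusion, objMap_inclusion]
    rfl
  · rintro _ - ⟨i, k, rfl⟩
    exact ⟨i, -k, by rw [map_neg]; rfl⟩

/-- Unitarity writes `m` as a finite signed sum of products `f • m'`. Each `f` comes from some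
`ℤH_i`, which puts the product in `ℤH_i · M`; a common stage contains the sum. -/
theorem isDirectedUnion_res (hmono : ∀ i j, i ≤ j → (H i).carrier ⊆ (H j).carrier)
    (hunion : ⋃ i, (H i).carrier = Set.univ) (M : Type v) [AddCommGroup M] [RngModule G.Alg M]
    (hM : RngModule.IsUnitary G.Alg M) :
    IsDirectedUnion (fun i j h => AddSubgroup.inclusion (resGroup_mono M (hmono i j h)))
      (fun i => ((H i).incl.resGroup M).subtype) := by
  refine ⟨fun _ _ _ _ => rfl, fun i => Subtype.val_injective, fun m => ?_⟩
  suffices h : ∃ i, m ∈ (H i).incl.resGroup M by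
    obtain ⟨i, h⟩ := h
    exact ⟨i, ⟨m, h⟩, rfl⟩
  have hm : m ∈ AddSubgroup.closure {m : M | ∃ (x : G.Alg) (m' : M), m = x • m'} := by
    rw [show _ = ⊤ from hM]
    trivial
  induction hm using AddSubgroup.closure_induction with
  | mem m h =>
    obtain ⟨f, m, rfl⟩ := h
    obtain ⟨i, k, rfl⟩ := (isDirectedUnion_alg hmono hunion).exists_rep f
    exact ⟨i, (H i).incl.smul_mem_resGroup M k m⟩
  | zero => exact ⟨Classical.arbitrary D, zero_mem _⟩
  | add a b _ _ ha hb =>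
    obtain ⟨i, hi⟩ := ha
    obtain ⟨j, hj⟩ := hb
    obtain ⟨k, hik, hjk⟩ := exists_ge_ge i j
    exact ⟨k, add_mem (resGroup_mono M (hmono i k hik) hi) (resGroup_mono M (hmono j k hjk) hj)⟩
  | neg a _ ha =>
    obtain ⟨i, hi⟩ := ha
    exact ⟨i, neg_mem hi⟩

/-! ### Continuity of homology -/

theorem isAddDirectLimit_res (hmono : ∀ i j, i ≤ j → (H i).carrier ⊆ (H j).carrier)
    (hunion : ⋃ i, (H i).carrier = Set.univ) (M : Type v) [AddCommGroup M] [RngModule G.Alg M]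
    (hM : RngModule.IsUnitary G.Alg M) (n : ℕ) :
    IsAddDirectLimit (fun i j h => resHomologyMap M (hmono i j h) n)
      (fun i => (H i).inclHomologyMap M n) :=
  UnitaryRightModule.isAddDirectLimit_tor (isDirectedUnion_alg hmono hunion)
    (α := fun i j h => (inclusion (hmono i j h)).trivialMap) (α' := fun i => (H i).incl.trivialMap)
    (isDirectedUnion_zObj hmono hunion) (isDirectedUnion_res hmono hunion M hM) _ _ n

/-- The coefficients `ℤH_i⁰` form a directed union with extension by zero as maps, so the result on
Tor applies directly, without identifying `ℤH_i⁰` with `ℤH_i · ℤG⁰`. -/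
theorem isAddDirectLimit_triv (hmono : ∀ i j, i ≤ j → (H i).carrier ⊆ (H j).carrier)
    (hunion : ⋃ i, (H i).carrier = Set.univ) (n : ℕ) :
    IsAddDirectLimit (fun i j h => trivHomologyMap (hmono i j h) n)
      (fun i => (H i).inclTrivHomologyMap n) :=
  UnitaryRightModule.isAddDirectLimit_tor (isDirectedUnion_alg hmono hunion)
    (α := fun i j h => (inclusion (hmono i j h)).trivialMap) (α' := fun i => (H i).incl.trivialMap)
    (isDirectedUnion_zObj hmono hunion) (isDirectedUnion_zObj hmono hunion) _ _ n

end OpenSubgroupoid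

end AmpleGroupoid

theorem theoremt (G : AmpleGroupoid.{u}) {D : Type w} [Preorder D]
    [IsDirectedOrder D] [Nonempty D] [DecidableEq D] (H : D → G.OpenSubgroupoid)
    (hmono : ∀ i j, i ≤ j → (H i).carrier ⊆ (H j).carrier)
    (hunion : ⋃ i, (H i).carrier = Set.univ) (n : ℕ) :
    (∀ (M : Type v) [AddCommGroup M] [RngModule G.Alg M], RngModule.IsUnitary G.Alg M →
      DirectedSystem (fun i => (H i).toGroupoid.Homology n ((H i).Res M))
        (fun i j hij => AmpleGroupoid.OpenSubgroupoid.resHomologyMap M (hmono i j hij) n) ∧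
      ∃ e : AddCommGroup.DirectLimit (fun i => (H i).toGroupoid.Homology n ((H i).Res M))
          (fun i j hij => AmpleGroupoid.OpenSubgroupoid.resHomologyMap M (hmono i j hij) n) ≃+
          G.Homology n M,
        ∀ i x, e (AddCommGroup.DirectLimit.of _ _ i x) = (H i).inclHomologyMap M n x) ∧
    (DirectedSystem (fun i => (H i).toGroupoid.Homology n (H i).toGroupoid.ZObj)
        (fun i j hij => AmpleGroupoid.OpenSubgroupoid.trivHomologyMap (hmono i j hij) n) ∧
      ∃ e : AddCommGroup.DirectLimit
          (fun i => (H i).toGroupoid.Homology n (H i).toGroupoid.ZObj)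
          (fun i j hij => AmpleGroupoid.OpenSubgroupoid.trivHomologyMap (hmono i j hij) n) ≃+
          G.Homology n G.ZObj,
        ∀ i x, e (AddCommGroup.DirectLimit.of _ _ i x) = (H i).inclTrivHomologyMap n x) :=
  ⟨fun M _ _ hM =>
    have h := AmpleGroupoid.OpenSubgroupoid.isAddDirectLimit_res hmono hunion M hM n
    ⟨h.directedSystem, h.exists_equiv⟩,
   have h := AmpleGroupoid.OpenSubgroupoid.isAddDirectLimit_triv hmono hunion n
   ⟨h.directedSystem, h.exists_equiv⟩⟩
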